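/- Let $n\ge 1$, $1<p<\infty$ and $0\le s<1+\frac1p$, and let $B$ be the open unit ball of $\mathbb R^n$. Let $\operatorname{Diff}_c(B)$ be the connected component of the identity in the group of compactly supported smooth diffeomorphisms of $B$, i.e. those that can be joined to $\operatorname{Id}$ by a smooth isotopy whose support lies in a compact subset of $B$. For a compactly supported smooth vector field $f$ on $B$, extended by zero to $\mathbb R^n$, write $s=k+\sigma$ with $k\in\{0,1,2,\dots\}$ and $\sigma\in[0,1)$, and put $$\|f\|_{W^{s,p}}=\sum_{j=0}^{k}\|D^jf\|_{L^p(\mathbb R^n)}+\left(\iint_{\mathbb R^n\times\mathbb R^n}\frac{|D^kf(x)-D^kf(y)|^p}{|x-y|^{n+\sigma p}}\,dx\,dy\right)^{1/p},$$ where the last term is omitted if $\sigma=0$. For $\varphi_0,\varphi_1\in\operatorname{Diff}_c(B)$ let $$\operatorname{dist}_{s,p}(\varphi_0,\varphi_1)=\inf_{\varphi}\int_0^1\|\partial_t\varphi_t\circ\varphi_t^{-1}\|_{W^{s,p}}\,dt,$$ where the infimum is over all smooth paths $\varphi:[0,1]\to\operatorname{Diff}_c(B)$ (jointly smooth in $(t,x)$,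 with supports in one compact subset of $B$) from $\varphi_0$ to $\varphi_1$. Then there is a constant $C=C(s,p,n)<\infty$ such that $$\operatorname{diam}_{s,p}\operatorname{Diff}_c(B)=\sup_{\varphi_0,\varphi_1\in\operatorname{Diff}_c(B)}\operatorname{dist}_{s,p}(\varphi_0,\varphi_1)<C.$$ -/

import Mathlib

open scoped Manifold ContDiff ENNReal NNReal

noncomputable section

namespace SobolevDiff

/-- Euclidean space `ℝⁿ`, with the Euclidean norm and Lebesgue measure. -/
abbrev E (n : ℕ) : Type := EuclideanSpace ℝ (Fin n)

/-! ### Sobolev–Slobodeckij norms on `ℝⁿ` -/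

/-- The Gagliardo seminorm of order `σ` and exponent `p` of the `k`-th differential of `f`:
`(∬ |Dᵏf(x) - Dᵏf(y)|ᵖ / |x - y|^(n + σ p) dx dy)^(1/p)`. -/
def gagliardoSeminorm {n : ℕ} (k : ℕ) (σ p : ℝ) (f : E n → E n) : ℝ≥0∞ :=
  (∫⁻ x : E n, ∫⁻ y : E n,
    ‖iteratedFDeriv ℝ k f x - iteratedFDeriv ℝ k f y‖ₑ ^ p /
      ‖x - y‖ₑ ^ ((n : ℝ) + σ * p)) ^ (1 / p)

/-- The integer order norm `‖f‖_{W^{k,p}} = ∑_{j ≤ k} ‖Dʲf‖_{Lᵖ}`. -/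
def integerSobolevNorm {n : ℕ} (k : ℕ) (p : ℝ) (f : E n → E n) : ℝ≥0∞ :=
  ∑ j ∈ Finset.range (k + 1),
    MeasureTheory.eLpNorm (iteratedFDeriv ℝ j f) (ENNReal.ofReal p) MeasureTheory.volume

/-- The norm `‖f‖_{W^{s,p}}` on `ℝⁿ`, for `s ≥ 0` and `1 < p < ∞`. With `s = k + σ`, where
`k = ⌊s⌋` and `σ ∈ [0, 1)`, it is `‖f‖_{W^{k,p}}` plus, if `σ ≠ 0`, the Gagliardo seminorm of
order `σ` of `Dᵏf`. The definition uses classical derivatives; it is applied to smooth compactly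
supported vector fields only. -/
def sobolevNorm {n : ℕ} (s p : ℝ) (f : E n → E n) : ℝ≥0∞ :=
  integerSobolevNorm ⌊s⌋₊ p f +
    if Int.fract s = 0 then 0 else gagliardoSeminorm ⌊s⌋₊ (Int.fract s) p f

/-! ### Compactly supported diffeomorphisms of an open set -/

/-- The compactly supported smooth diffeomorphisms of the open set `U ⊆ ℝⁿ`. Such a
diffeomorphism extends by the identity to all of `ℝⁿ`, and is identified with its extension. -/
def DiffC {n : ℕ} (U : Set (E n)) : Type :=
  {φ : E n ≃ₘ[ℝ] E n //
    HasCompactSupport (fun x => φ x - x) ∧ tsupport (fun x => φ x - x) ⊆ U}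

/-- The identity map, as a compactly supported diffeomorphism. -/
def DiffC.id {n : ℕ} (U : Set (E n)) : DiffC U :=
  ⟨Diffeomorph.refl 𝓘(ℝ, E n) (E n) ∞, by
    have h : (fun x : E n => (Diffeomorph.refl 𝓘(ℝ, E n) (E n) ∞) x - x) = 0 := by
      funext x; simp
    rw [h]
    exact ⟨HasCompactSupport.zero, by simp⟩⟩

/-- `Φ`, restricted to times `t ∈ [0, 1]`, is a smooth path in `Diff_c(U)`: it is jointly smooth
in time and space, and the supports stay in one compact subset of `U`. -/
structure IsSmoothPath {n : ℕ} {U : Set (E n)} (Φ : ℝ → DiffC U) : Prop where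
  smooth : ContDiffOn ℝ ∞ (fun q : ℝ × E n => (Φ q.1).1 q.2)
    (Set.Icc (0 : ℝ) 1 ×ˢ (Set.univ : Set (E n)))
  support : ∃ K : Set (E n), IsCompact K ∧ K ⊆ U ∧
    ∀ t ∈ Set.Icc (0 : ℝ) 1, ∀ x, x ∉ K → (Φ t).1 x = x

/-- The right-trivialized velocity `∂ₜφₜ ∘ φₜ⁻¹` of a path at time `t ∈ [0, 1]` (one-sided time
derivatives at the two endpoints). -/
def velocity {n : ℕ} {U : Set (E n)} (Φ : ℝ → DiffC U) (t : ℝ) : E n → E n :=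
  fun y => derivWithin (fun τ : ℝ => (Φ τ).1 ((Φ t).1.symm y)) (Set.Icc (0 : ℝ) 1) t

/-- The length `∫₀¹ ‖∂ₜφₜ ∘ φₜ⁻¹‖_{W^{s,p}} dt` of a path. -/
def length {n : ℕ} {U : Set (E n)} (s p : ℝ) (Φ : ℝ → DiffC U) : ℝ≥0∞ :=
  ∫⁻ t in Set.Icc (0 : ℝ) 1, sobolevNorm s p (velocity Φ t)

/-- The geodesic distance of the right-invariant `W^{s,p}` metric on `Diff_c(U)`. -/
def geodesicDist {n : ℕ} {U : Set (E n)} (s p : ℝ) (φ₀ φ₁ : DiffC U) : ℝ≥0∞ :=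
  ⨅ (Φ : ℝ → DiffC U) (_ : IsSmoothPath Φ ∧ Φ 0 = φ₀ ∧ Φ 1 = φ₁), length s p Φ

/-- The connected component of the identity in `Diff_c(U)`: the diffeomorphisms that can be joined
to the identity by a smooth path, that is, by a compactly supported isotopy of `U`. -/
def identityComponent {n : ℕ} (U : Set (E n)) : Set (DiffC U) :=
  {φ | ∃ Φ : ℝ → DiffC U, IsSmoothPath Φ ∧ Φ 0 = DiffC.id U ∧ Φ 1 = φ}

/-- The diameter of the identity component of `Diff_c(U)` in the right-invariant `W^{s,p}`
metric. -/
def diameter {n : ℕ} (s p : ℝ) (U : Set (E n)) : ℝ≥0∞ :=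
  ⨆ φ₀ ∈ identityComponent U, ⨆ φ₁ ∈ identityComponent U, geodesicDist s p φ₀ φ₁

end SobolevDiff

end

noncomputable section

namespace SobolevDiff

open MeasureTheory Set

/-! Call a field tame at scale `τ` if it has size `τ`, varies on the length scale `τ`, and lives on
a set of volume `O(τ)`. Its derivative of order `j ≤ 1` has size `τ ^ (1 - j)`, and the support
contributes a factor `τ ^ (1 / p)`, so its `W^{s,p}` norm is `O(τ ^ (1 + 1 / p - s))`
(`exists_sobolevNorm_le`). Below the critical order this exponent is positive. Infinitely many tame
moves along a geometric sequence of scales therefore have finite total cost, bounded independently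
of how many are made.

Two families of moves use this. Fields on thin shells near the unit sphere push any compact set into
`‖x‖ ^ 2 ≤ 1 / 2` (`exists_reach_push_inside`); however close the set is to the sphere, the cost
stays bounded. Fields on small balls compress `‖x‖ ^ 2 ≤ 1 / 2` linearly by `q ^ J`, again at a cost
independent of `J` (`exists_reach_linear_compression`). In both, a step at scale `τ` is a
displacement `x ↦ x + U x` with `U` tame, realised by scaling `U` up in time
(`exists_reach_displacement`).

Now let an arbitrary isotopy end at `φ`. Push its support inside by `P`, and compress by `Q`.
Conjugating by `P` and then by a homothety of ratio `q ^ J` gives an isotopy whose cost tends to `0`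
as `J` grows, hence is at most `1` for some `J` (`exists_cost_rescale_le_one`). Since `Q` is that
homothety on the relevant support, `φ` equals `P⁻¹ Q⁻¹ φ' Q P`, where `φ'` is the end of the cheap
isotopy (`exists_reach_bound`). Each of the five factors has bounded cost. Right invariance turns
this into a bound on the distance between any two elements. -/

/-! ### Sobolev norms of fields concentrated at a small scale -/

/-- The truncated Gagliardo kernel at scale `τ`. -/
def truncKernel (p a τ r : ℝ) : ℝ := (min 2 (r / τ)) ^ p * r ^ (-a)

lemma truncKernel_nonneg (p a : ℝ) {τ r : ℝ} (hτ : 0 < τ) (hr : 0 ≤ r) :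
    0 ≤ truncKernel p a τ r := by
  unfold truncKernel
  have : 0 ≤ min 2 (r / τ) := le_min (by norm_num) (by positivity)
  positivity

lemma measurable_truncKernel (p a τ : ℝ) : Measurable (truncKernel p a τ) := by
  unfold truncKernel
  fun_prop

lemma truncKernel_scale (p a : ℝ) {τ r : ℝ} (hτ : 0 < τ) (hr : 0 ≤ r) :
    truncKernel p a τ r = τ ^ (-a) * truncKernel p a 1 (r / τ) := by
  unfold truncKernel
  rw [Real.div_rpow hr hτ.le, div_one]
  have : τ ^ (-a) ≠ 0 := (Real.rpow_pos_of_pos hτ _).ne'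
  field_simp

/-- In polar coordinates the integrand is `r ^ (p - 1 - σ * p)` near `0` and a multiple of `r ^ (-1
- σ * p)` at infinity. The first is integrable because `σ < 1`, the second because `σ > 0`. -/
lemma integrable_truncKernel {n : ℕ} (hn : 1 ≤ n) {p σ : ℝ} (hp : 1 < p) (hσ : 0 < σ)
    (hσ1 : σ < 1) :
    Integrable (fun x : E n => truncKernel p (n + σ * p) 1 ‖x‖) := by
  have : Nontrivial (E n) := by
    apply Module.nontrivial_of_finrank_pos (R := ℝ)
    simp; omega
  rw [integrable_fun_norm_addHaar volume, ← Ioc_union_Ioi_eq_Ioi zero_le_one]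
  have hmeas : Measurable fun y : ℝ =>
      y ^ (Module.finrank ℝ (E n) - 1) • truncKernel p (n + σ * p) 1 y := by
    have := measurable_truncKernel p (n + σ * p) 1
    fun_prop
  have hpos : ∀ y : ℝ, 0 < y →
      ‖y ^ (Module.finrank ℝ (E n) - 1) • truncKernel p (n + σ * p) 1 y‖ =
        (min 2 y) ^ p * y ^ (-1 - σ * p) := by
    intro y hy
    have hk := truncKernel_nonneg p (n + σ * p) one_pos hy.le
    rw [Real.norm_of_nonneg (by positivity)]
    unfold truncKernel
    rw [← Real.rpow_natCast, smul_eq_mul, mul_left_comm, ← Real.rpow_add hy, div_one]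
    congr 2
    simp only [finrank_euclideanSpace, Fintype.card_fin]
    push_cast [Nat.cast_sub hn]
    ring
  refine IntegrableOn.union ?_ ?_
  · have h1 : IntegrableOn (fun y : ℝ => y ^ (p - 1 - σ * p)) (Ioc 0 1) := by
      rw [integrableOn_Ioc_iff_integrableOn_Ioo,
        intervalIntegral.integrableOn_Ioo_rpow_iff one_pos]
      nlinarith
    refine h1.mono' hmeas.aestronglyMeasurable ?_
    refine (ae_restrict_iff' measurableSet_Ioc).2 (.of_forall fun y hy => ?_)
    rw [hpos y hy.1, min_eq_right (by linarith [hy.2]), ← Real.rpow_add hy.1]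
    apply le_of_eq; congr 1; ring
  · have h1 : IntegrableOn (fun y : ℝ => 2 ^ p * y ^ (-1 - σ * p)) (Ioi 1) :=
      (integrableOn_Ioi_rpow_of_lt (by nlinarith) one_pos).const_mul _
    refine h1.mono' hmeas.aestronglyMeasurable ?_
    refine (ae_restrict_iff' measurableSet_Ioi).2 (.of_forall fun y hy => ?_)
    have hy0 : (0 : ℝ) < y := lt_trans one_pos hy
    rw [hpos y hy0]
    gcongr
    exact min_le_left _ _

lemma lintegral_truncKernel_scale {n : ℕ} (p a : ℝ) {τ : ℝ} (hτ : 0 < τ) :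
    ∫⁻ x : E n, ENNReal.ofReal (truncKernel p a τ ‖x‖) =
      ENNReal.ofReal (τ ^ (n - a)) * ∫⁻ x : E n, ENNReal.ofReal (truncKernel p a 1 ‖x‖) := by
  have hm : Measurable fun x : E n => ENNReal.ofReal (truncKernel p a 1 ‖x‖) :=
    ((measurable_truncKernel p a 1).comp measurable_norm).ennreal_ofReal
  have h1 : ∀ x : E n, ENNReal.ofReal (truncKernel p a τ ‖x‖) =
      ENNReal.ofReal (τ ^ (-a)) * ENNReal.ofReal (truncKernel p a 1 ‖τ⁻¹ • x‖) := by
    intro x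
    rw [truncKernel_scale p a hτ (norm_nonneg x), ENNReal.ofReal_mul (by positivity), norm_smul,
      Real.norm_of_nonneg (by positivity), div_eq_inv_mul]
  simp_rw [h1]
  rw [lintegral_const_mul' _ _ ENNReal.ofReal_ne_top, ← lintegral_map hm (by fun_prop),
    Measure.map_addHaar_smul _ (by positivity), lintegral_smul_measure, smul_eq_mul, ← mul_assoc,
    ← ENNReal.ofReal_mul (by positivity)]
  congr 2
  simp only [finrank_euclideanSpace, Fintype.card_fin]
  rw [inv_pow, inv_inv, abs_of_pos (by positivity), ← Real.rpow_natCast, ← Real.rpow_add hτ]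
  congr 1; ring

/-- The Gagliardo energy of a function that is bounded by `A`, is `A / τ`-Lipschitz, and vanishes
off a set of volume `v`. -/
lemma exists_gagliardo_le {n : ℕ} (hn : 1 ≤ n) {p σ : ℝ} (hp : 1 < p) (hσ : 0 < σ)
    (hσ1 : σ < 1) :
    ∃ I : ℝ, 0 ≤ I ∧ ∀ {F : Type} [NormedAddCommGroup F] (f : E n → F) {A τ v : ℝ} {S : Set (E n)},
      0 ≤ A → 0 < τ → 0 ≤ v → MeasurableSet S → volume S ≤ ENNReal.ofReal v →
      (∀ x, ‖f x‖ ≤ A) → (∀ x y, ‖f x - f y‖ ≤ A / τ * ‖x - y‖) → (∀ x, x ∉ S → f x = 0) →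
      ∫⁻ x : E n, ∫⁻ y : E n, ‖f x - f y‖ₑ ^ p / ‖x - y‖ₑ ^ ((n : ℝ) + σ * p) ≤
        ENNReal.ofReal (I * (v * (A ^ p * τ ^ (-(σ * p))))) := by
  set a : ℝ := n + σ * p with ha
  have ha0 : 0 < a := by positivity
  have hint := integrable_truncKernel hn hp hσ hσ1
  set J : ℝ := ∫ x : E n, truncKernel p a 1 ‖x‖ with hJ
  have hJ' : ∫⁻ x : E n, ENNReal.ofReal (truncKernel p a 1 ‖x‖) = ENNReal.ofReal J :=
    (ofReal_integral_eq_lintegral_ofReal hint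
      (.of_forall fun x => truncKernel_nonneg p a one_pos (norm_nonneg x))).symm
  have hJ0 : 0 ≤ J := integral_nonneg fun x => truncKernel_nonneg p a one_pos (norm_nonneg x)
  refine ⟨2 * J, by positivity, ?_⟩
  intro F _ f A τ v S hA hτ hv hS hvol hb hl hz
  set k : E n → ℝ≥0∞ := fun h => ENNReal.ofReal (truncKernel p a τ ‖h‖) with hk
  have hkm : Measurable k := ((measurable_truncKernel p a τ).comp measurable_norm).ennreal_ofReal
  set χ : E n → ℝ≥0∞ := S.indicator 1 with hχ
  have hχm : Measurable χ := measurable_one.indicator hS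
  have hχi : ∫⁻ x, χ x ≤ ENNReal.ofReal v := by
    rw [hχ, lintegral_indicator_one hS]; exact hvol
  -- The difference quotient vanishes unless `x` or `y` lies in `S`, so it may be multiplied by `χ x
  -- + χ y`. Each summand then integrates to (mass of `χ`) × (mass of the kernel), by translation
  -- invariance.
  have key : ∀ x y, ‖f x - f y‖ₑ ^ p / ‖x - y‖ₑ ^ a ≤
      ENNReal.ofReal (A ^ p) * (χ x * k (x - y) + χ y * k (x - y)) := by
    intro x y
    by_cases hxy : x = y
    · subst hxy
      simp [ENNReal.zero_rpow_of_pos (by linarith : (0 : ℝ) < p)]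
    by_cases hxS : x ∉ S ∧ y ∉ S
    · rw [hz x hxS.1, hz y hxS.2]
      simp [ENNReal.zero_rpow_of_pos (by linarith : (0 : ℝ) < p)]
    have h1 : (1 : ℝ≥0∞) ≤ χ x + χ y := by
      rw [not_and_or, not_not, not_not] at hxS
      rcases hxS with h | h <;> simp [hχ, h]
    have hr : 0 < ‖x - y‖ := norm_pos_iff.2 (sub_ne_zero.2 hxy)
    have h2 : ‖f x - f y‖ₑ ^ p / ‖x - y‖ₑ ^ a ≤ ENNReal.ofReal (A ^ p) * k (x - y) := by
      rw [← ofReal_norm, ← ofReal_norm, ENNReal.ofReal_rpow_of_nonneg (norm_nonneg _) (by linarith),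
        ENNReal.ofReal_rpow_of_nonneg (norm_nonneg _) ha0.le,
        ← ENNReal.ofReal_div_of_pos (by positivity), hk, ← ENNReal.ofReal_mul (by positivity)]
      apply ENNReal.ofReal_le_ofReal
      -- The sup bound wins at distances beyond `2 * τ`, the Lipschitz bound below; together they
      -- give exactly the truncation in the kernel.
      have h3 : ‖f x - f y‖ ≤ A * min 2 (‖x - y‖ / τ) := by
        rw [mul_min_of_nonneg _ _ hA]
        refine le_min ?_ ((hl x y).trans_eq (by ring))
        linarith [norm_sub_le (f x) (f y), hb x, hb y]
      unfold truncKernel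
      rw [Real.rpow_neg hr.le, ← div_eq_mul_inv, ← mul_div_assoc,
        ← Real.mul_rpow hA (le_min (by norm_num) (by positivity))]
      gcongr
    calc _ ≤ 1 * (ENNReal.ofReal (A ^ p) * k (x - y)) := by rwa [one_mul]
      _ ≤ (χ x + χ y) * (ENNReal.ofReal (A ^ p) * k (x - y)) := by gcongr
      _ = _ := by ring
  have hksub : ∀ x, ∫⁻ y, k (x - y) = ∫⁻ y, k y := fun x => lintegral_sub_left_eq_self k x
  have hksub' : ∀ y, ∫⁻ x, k (x - y) = ∫⁻ y, k y := fun y => lintegral_sub_right_eq_self k y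
  have hm1 : Measurable fun q : E n × E n => χ q.1 * k (q.1 - q.2) := by fun_prop
  have hm2 : Measurable fun q : E n × E n => χ q.2 * k (q.1 - q.2) := by fun_prop
  calc ∫⁻ x : E n, ∫⁻ y : E n, ‖f x - f y‖ₑ ^ p / ‖x - y‖ₑ ^ a
      ≤ ∫⁻ x : E n, ∫⁻ y : E n,
          ENNReal.ofReal (A ^ p) * (χ x * k (x - y) + χ y * k (x - y)) :=
        lintegral_mono fun x => lintegral_mono fun y => key x y
    _ = ENNReal.ofReal (A ^ p) * ((∫⁻ x, ∫⁻ y, χ x * k (x - y)) + ∫⁻ x, ∫⁻ y, χ y * k (x - y)) := by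
        have hm1' : Measurable fun x => ∫⁻ y, χ x * k (x - y) := hm1.lintegral_prod_right'
        rw [← lintegral_add_left hm1', ← lintegral_const_mul' _ _ ENNReal.ofReal_ne_top]
        refine lintegral_congr fun x => ?_
        rw [lintegral_const_mul' _ _ ENNReal.ofReal_ne_top, lintegral_add_left (by fun_prop)]
    _ = ENNReal.ofReal (A ^ p) * (2 * ((∫⁻ x, χ x) * ∫⁻ y, k y)) := by
        rw [lintegral_lintegral_swap (f := fun x y => χ y * k (x - y)) hm2.aemeasurable]
        have e1 : ∀ x, ∫⁻ y, χ x * k (x - y) = χ x * ∫⁻ y, k y := fun x => by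
          rw [lintegral_const_mul _ (by fun_prop), hksub]
        have e2 : ∀ y, ∫⁻ x, χ y * k (x - y) = χ y * ∫⁻ y, k y := fun y => by
          rw [lintegral_const_mul _ (by fun_prop), hksub']
        simp_rw [e1, e2]
        rw [lintegral_mul_const _ hχm, two_mul]
    _ ≤ ENNReal.ofReal (A ^ p) *
          (2 * (ENNReal.ofReal v * (ENNReal.ofReal (τ ^ (n - a)) * ENNReal.ofReal J))) := by
        rw [← hJ', ← lintegral_truncKernel_scale p a hτ]
        gcongr
    _ = _ := by
        rw [← ENNReal.ofReal_mul (by positivity), ← ENNReal.ofReal_mul (by positivity),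
          show (2 : ℝ≥0∞) = ENNReal.ofReal 2 by simp, ← ENNReal.ofReal_mul (by positivity),
          ← ENNReal.ofReal_mul (by positivity)]
        congr 1
        rw [show (n : ℝ) - a = -(σ * p) by rw [ha]; ring]
        ring

/-- A field of size `τ` that oscillates at the length scale `τ` on a set of volume `τ`, with
implied constant `M`. -/
structure IsTame {n : ℕ} (M τ : ℝ) (V : E n → E n) : Prop where
  norm_le : ∀ x, ‖V x‖ ≤ M * τ
  norm_fderiv_le : ∀ x, ‖fderiv ℝ V x‖ ≤ M
  norm_fderiv_sub_le : ∀ x y, ‖fderiv ℝ V x - fderiv ℝ V y‖ ≤ M / τ * ‖x - y‖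
  differentiable : Differentiable ℝ V
  exists_support : ∃ S : Set (E n), IsClosed S ∧ volume S ≤ ENNReal.ofReal (M * τ) ∧
    ∀ x, x ∉ S → V x = 0

lemma norm_iteratedFDeriv_one_sub_le {n : ℕ} (V : E n → E n) (x y : E n) :
    ‖iteratedFDeriv ℝ 1 V x - iteratedFDeriv ℝ 1 V y‖ ≤ ‖fderiv ℝ V x - fderiv ℝ V y‖ := by
  refine ContinuousMultilinearMap.opNorm_le_bound (norm_nonneg _) fun m => ?_
  simp only [sub_apply, iteratedFDeriv_one_apply]
  simpa using (fderiv ℝ V x - fderiv ℝ V y).le_opNorm (m 0)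

lemma norm_iteratedFDeriv_zero_sub {n : ℕ} (V : E n → E n) (x y : E n) :
    ‖iteratedFDeriv ℝ 0 V x - iteratedFDeriv ℝ 0 V y‖ = ‖V x - V y‖ := by
  simp only [iteratedFDeriv_zero_eq_comp, Function.comp_apply]
  rw [← map_sub, LinearIsometryEquiv.norm_map]

lemma IsTame.fderiv_eq_zero {n : ℕ} {V : E n → E n} {S : Set (E n)} (hS : IsClosed S)
    (hz : ∀ x, x ∉ S → V x = 0) {x : E n} (hx : x ∉ S) : fderiv ℝ V x = 0 := by
  have : V =ᶠ[nhds x] fun _ => 0 := by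
    filter_upwards [hS.isOpen_compl.mem_nhds hx] with y hy using hz y hy
  rw [this.fderiv_eq]; simp

lemma IsTame.iteratedFDeriv_bounds {n : ℕ} {M τ : ℝ} {V : E n → E n} (h : IsTame M τ V)
    (hτ : 0 < τ) {j : ℕ} (hj : j ≤ 1) :
    (∀ x, ‖iteratedFDeriv ℝ j V x‖ ≤ M * τ ^ (1 - j : ℝ)) ∧
      ∀ x y, ‖iteratedFDeriv ℝ j V x - iteratedFDeriv ℝ j V y‖ ≤
        M * τ ^ (1 - j : ℝ) / τ * ‖x - y‖ := by
  interval_cases j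
  · simp only [Nat.cast_zero, sub_zero, Real.rpow_one, norm_iteratedFDeriv_zero]
    refine ⟨h.norm_le, fun x y => ?_⟩
    rw [norm_iteratedFDeriv_zero_sub, mul_div_cancel_right₀ _ hτ.ne']
    exact convex_univ.norm_image_sub_le_of_norm_fderiv_le (fun z _ => h.differentiable z)
      (fun z _ => h.norm_fderiv_le z) (mem_univ y) (mem_univ x)
  · simp only [Nat.cast_one, sub_self, Real.rpow_zero, mul_one]
    refine ⟨fun x => ?_, fun x y => ?_⟩
    · rw [norm_iteratedFDeriv_one]; exact h.norm_fderiv_le x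
    · exact (norm_iteratedFDeriv_one_sub_le V x y).trans (h.norm_fderiv_sub_le x y)

lemma IsTame.iteratedFDeriv_eq_zero {n : ℕ} {V : E n → E n} {S : Set (E n)} (hS : IsClosed S)
    (hz : ∀ x, x ∉ S → V x = 0) {x : E n} (hx : x ∉ S) (j : ℕ) : iteratedFDeriv ℝ j V x = 0 := by
  have : V =ᶠ[nhds x] fun _ => 0 := by
    filter_upwards [hS.isOpen_compl.mem_nhds hx] with y hy using hz y hy
  rw [(this.iteratedFDeriv ℝ j).eq_of_nhds]
  exact congrFun (iteratedFDeriv_fun_zero (𝕜 := ℝ) (n := j)) x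

lemma eLpNorm_le_of_bound_of_support {n : ℕ} {F : Type*} [NormedAddCommGroup F] {p A v : ℝ}
    (hp : 1 < p) (hA : 0 ≤ A) (hv : 0 ≤ v) {f : E n → F} {S : Set (E n)}
    (hvol : volume S ≤ ENNReal.ofReal v) (hb : ∀ x, ‖f x‖ ≤ A) (hz : ∀ x, x ∉ S → f x = 0) :
    eLpNorm f (ENNReal.ofReal p) volume ≤ ENNReal.ofReal (A * v ^ (1 / p)) := by
  have h1 : ∀ x, ‖f x‖ ≤ ‖S.indicator (fun _ => A) x‖ := by
    intro x
    by_cases hx : x ∈ S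
    · simpa [hx, abs_of_nonneg hA] using hb x
    · simp [hx, hz x hx]
  refine (eLpNorm_mono h1).trans ((eLpNorm_indicator_const_le _ _).trans ?_)
  rw [ENNReal.toReal_ofReal (by linarith), ENNReal.ofReal_mul hA,
    ← ENNReal.ofReal_rpow_of_nonneg hv (by positivity)]
  gcongr
  rw [← ofReal_norm, Real.norm_of_nonneg hA]

/-- The source of the threshold on `s`. Since `s < 2`, only derivatives of order at most one occur,
and the Lipschitz bound on the first derivative controls its Gagliardo energy. The terms of order `j
≤ ⌊s⌋₊` scale like `τ ^ (1 + 1 / p - j)`, which for `τ ≤ 1` is no larger than the claimed power. -/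
theorem exists_sobolevNorm_le {n : ℕ} (hn : 1 ≤ n) {p s : ℝ} (hp : 1 < p) (hs0 : 0 ≤ s)
    (hs : s < 1 + 1 / p) {M : ℝ} (hM : 0 ≤ M) :
    ∃ C : ℝ, 0 ≤ C ∧ ∀ (τ : ℝ) (V : E n → E n), 0 < τ → τ ≤ 1 → IsTame M τ V →
      sobolevNorm s p V ≤ ENNReal.ofReal (C * τ ^ (1 + 1 / p - s)) := by
  have hk1 : ⌊s⌋₊ ≤ 1 := by
    have : 1 / p < 1 := by rw [div_lt_one (by linarith)]; exact hp
    have : ⌊s⌋₊ < 2 := by rw [Nat.floor_lt hs0]; push_cast; linarith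
    omega
  have hks : (⌊s⌋₊ : ℝ) ≤ s := Nat.floor_le hs0
  have hfr : (⌊s⌋₊ : ℝ) + Int.fract s = s := by
    rw [natCast_floor_eq_intCast_floor hs0]; exact Int.floor_add_fract s
  set k := ⌊s⌋₊ with hk
  set σ := Int.fract s with hσ
  have hL : ∀ (τ : ℝ) (V : E n → E n), 0 < τ → τ ≤ 1 → IsTame M τ V →
      integerSobolevNorm k p V ≤
        ENNReal.ofReal (((k + 1 : ℕ) : ℝ) * (M * M ^ (1 / p)) * τ ^ (1 + 1 / p - s)) := by
    intro τ V hτ hτ1 hV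
    obtain ⟨S, hS, hvol, hz⟩ := hV.exists_support
    have h1 : ∀ j ∈ Finset.range (k + 1),
        eLpNorm (iteratedFDeriv ℝ j V) (ENNReal.ofReal p) volume ≤
          ENNReal.ofReal ((M * M ^ (1 / p)) * τ ^ (1 + 1 / p - s)) := by
      intro j hj
      have hjk : j ≤ k := Nat.lt_succ_iff.1 (Finset.mem_range.1 hj)
      refine (eLpNorm_le_of_bound_of_support hp (by positivity) (by positivity) hvol
        (hV.iteratedFDeriv_bounds hτ (hjk.trans hk1)).1
        (fun x hx => IsTame.iteratedFDeriv_eq_zero hS hz hx j)).trans ?_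
      apply ENNReal.ofReal_le_ofReal
      rw [Real.mul_rpow hM hτ.le, mul_mul_mul_comm, ← Real.rpow_add hτ]
      refine mul_le_mul_of_nonneg_left (Real.rpow_le_rpow_of_exponent_ge hτ hτ1 ?_) (by positivity)
      have : (j : ℝ) ≤ k := by exact_mod_cast hjk
      linarith
    refine (Finset.sum_le_sum h1).trans (le_of_eq ?_)
    rw [Finset.sum_const, Finset.card_range, nsmul_eq_mul, mul_assoc ((k + 1 : ℕ) : ℝ),
      ENNReal.ofReal_mul (p := ((k + 1 : ℕ) : ℝ)) (by positivity), ENNReal.ofReal_natCast]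
  by_cases h0 : σ = 0
  · refine ⟨((k + 1 : ℕ) : ℝ) * (M * M ^ (1 / p)), by positivity, fun τ V hτ hτ1 hV => ?_⟩
    rw [sobolevNorm, if_pos h0, add_zero]
    exact hL τ V hτ hτ1 hV
  · have hσ0 : 0 < σ := lt_of_le_of_ne (Int.fract_nonneg s) (Ne.symm h0)
    obtain ⟨I, hI, hG⟩ := exists_gagliardo_le hn hp hσ0 (Int.fract_lt_one s)
    refine ⟨((k + 1 : ℕ) : ℝ) * (M * M ^ (1 / p)) + (I * M) ^ (1 / p) * M, by positivity,
      fun τ V hτ hτ1 hV => ?_⟩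
    rw [sobolevNorm, if_neg h0, add_mul, ENNReal.ofReal_add (by positivity) (by positivity)]
    refine add_le_add (hL τ V hτ hτ1 hV) ?_
    obtain ⟨S, hS, hvol, hz⟩ := hV.exists_support
    have hb := hV.iteratedFDeriv_bounds hτ hk1
    have := hG (iteratedFDeriv ℝ k V) (by positivity) hτ (by positivity) hS.measurableSet hvol
      hb.1 hb.2 (fun x hx => IsTame.iteratedFDeriv_eq_zero hS hz hx k)
    unfold gagliardoSeminorm
    refine (ENNReal.rpow_le_rpow this (by positivity)).trans (le_of_eq ?_)
    rw [ENNReal.ofReal_rpow_of_nonneg (by positivity) (by positivity)]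
    congr 1
    -- Power count under the `p`-th root: volume `τ`, amplitude `τ ^ (1 - k)`, and `τ ^ (-(σ * p))`
    -- from the kernel, with `k + σ = s`.
    have e : I * (M * τ * ((M * τ ^ (1 - k : ℝ)) ^ p * τ ^ (-(σ * p)))) =
        (I * M) * (M ^ p * (τ ^ (1 + 1 / p - s)) ^ p) := by
      rw [Real.mul_rpow hM (by positivity), ← Real.rpow_mul hτ.le, ← Real.rpow_mul hτ.le,
        show (1 + 1 / p - s) * p = 1 + ((1 - k) * p + -(σ * p)) by
          rw [← hfr]; field_simp; ring,
        Real.rpow_add hτ, Real.rpow_add hτ, Real.rpow_one]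
      ring
    rw [e, Real.mul_rpow (by positivity) (by positivity), ← Real.mul_rpow hM (by positivity),
      ← Real.rpow_mul (by positivity), mul_one_div_cancel (by linarith), Real.rpow_one, mul_assoc]

/-! ### Scaling a field by a constant -/

lemma sobolevNorm_const_smul {n : ℕ} {p s : ℝ} (hp : 1 < p) (c : ℝ)
    {V : E n → E n} (hV : ContDiff ℝ ∞ V) :
    sobolevNorm s p (fun x => c • V x) = ‖c‖ₑ * sobolevNorm s p V := by
  have h1 : ∀ j : ℕ, iteratedFDeriv ℝ j (fun x => c • V x) = fun x => c • iteratedFDeriv ℝ j V x :=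
    fun j => funext fun x => iteratedFDeriv_const_smul_apply (a := c) (f := V) (x := x)
      (hV.contDiffAt.of_le (by exact_mod_cast le_top))
  unfold sobolevNorm integerSobolevNorm
  rw [mul_add, Finset.mul_sum]
  congr 1
  · refine Finset.sum_congr rfl fun j _ => ?_
    rw [h1]
    exact eLpNorm_const_smul c _ _ _
  · split_ifs with h
    · simp
    unfold gagliardoSeminorm
    have h2 : ∀ x y : E n, ‖iteratedFDeriv ℝ ⌊s⌋₊ (fun x => c • V x) x -
        iteratedFDeriv ℝ ⌊s⌋₊ (fun x => c • V x) y‖ₑ ^ p / ‖x - y‖ₑ ^ (n + Int.fract s * p) =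
        ‖c‖ₑ ^ p * (‖iteratedFDeriv ℝ ⌊s⌋₊ V x - iteratedFDeriv ℝ ⌊s⌋₊ V y‖ₑ ^ p /
          ‖x - y‖ₑ ^ (n + Int.fract s * p)) := by
      intro x y
      rw [h1, ← smul_sub, enorm_smul, ENNReal.mul_rpow_of_nonneg _ _ (by linarith), mul_div_assoc]
    have hc : ‖c‖ₑ ^ p ≠ ⊤ := by simp [ENNReal.rpow_eq_top_iff]; intro; linarith
    simp_rw [h2, lintegral_const_mul' _ _ hc]
    rw [ENNReal.mul_rpow_of_nonneg _ _ (by positivity), ← ENNReal.rpow_mul,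
      mul_one_div_cancel (by linarith), ENNReal.rpow_one]

/-! ### Compactly supported isotopies of the unit ball -/

/-- A smooth isotopy of the unit ball with compact support, constant before time `0` (where it is
the identity) and after time `T`. The maps `g t` are the inverses of the maps `f t`. -/
structure Isotopy (n : ℕ) where
  f : ℝ → E n → E n
  g : ℝ → E n → E n
  T : ℝ
  K : Set (E n)
  T_pos : 0 < T
  smooth_f : ContDiff ℝ ∞ fun q : ℝ × E n => f q.1 q.2
  smooth_g : ContDiff ℝ ∞ fun q : ℝ × E n => g q.1 q.2
  left_inv : ∀ t x, g t (f t x) = x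
  right_inv : ∀ t x, f t (g t x) = x
  isCompact_K : IsCompact K
  K_subset : K ⊆ Metric.ball 0 1
  eq_off : ∀ t x, x ∉ K → f t x = x
  before : ∀ t ≤ 0, ∀ x, f t x = x
  after : ∀ t, T ≤ t → ∀ x, f t x = f T x

namespace Isotopy

variable {n : ℕ} (I : Isotopy n)

/-- The right-trivialized velocity of an isotopy. -/
def velocity (t : ℝ) : E n → E n := fun y => deriv (fun τ => I.f τ (I.g t y)) t

/-- The length of an isotopy in the right-invariant `W^{s,p}` metric. -/
def cost (s p : ℝ) : ℝ≥0∞ := ∫⁻ t, sobolevNorm s p (I.velocity t)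

lemma velocity_eq (t : ℝ) (y : E n) :
    I.velocity t y = fderiv ℝ (fun q : ℝ × E n => I.f q.1 q.2) (t, I.g t y) (1, 0) := by
  have h1 : HasFDerivAt (fun q : ℝ × E n => I.f q.1 q.2)
      (fderiv ℝ (fun q : ℝ × E n => I.f q.1 q.2) (t, I.g t y)) (t, I.g t y) :=
    (I.smooth_f.differentiable (by simp) _).hasFDerivAt
  have h2 : HasDerivAt (fun τ : ℝ => (τ, I.g t y)) ((1 : ℝ), (0 : E n)) t :=
    (hasDerivAt_id t).prodMk (hasDerivAt_const t _)
  exact (HasFDerivAt.comp_hasDerivAt (x := t) (f := fun τ : ℝ => (τ, I.g t y)) h1 h2).deriv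

lemma contDiff_velocity : ContDiff ℝ ∞ fun q : ℝ × E n => I.velocity q.1 q.2 := by
  simp_rw [velocity_eq]
  have h1 : ContDiff ℝ ∞ (fderiv ℝ fun q : ℝ × E n => I.f q.1 q.2) :=
    I.smooth_f.fderiv_right (by simp)
  exact (h1.comp (contDiff_fst.prodMk I.smooth_g)).clm_apply contDiff_const

lemma g_eq_off (t : ℝ) {x : E n} (hx : x ∉ I.K) : I.g t x = x := by
  conv_lhs => rw [← I.eq_off t x hx]
  exact I.left_inv t x

lemma velocity_eq_zero_of_notMem (t : ℝ) {x : E n} (hx : x ∉ I.K) : I.velocity t x = 0 := by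
  unfold velocity
  rw [I.g_eq_off t hx]
  simp_rw [fun τ => I.eq_off τ x hx]
  exact deriv_const t x

lemma differentiable_f_left (x : E n) : Differentiable ℝ fun t => I.f t x :=
  (I.smooth_f.comp (contDiff_id.prodMk contDiff_const)).differentiable (by simp)

lemma velocity_of_neg {t : ℝ} (ht : t < 0) : I.velocity t = 0 := by
  funext y
  have : (fun τ => I.f τ (I.g t y)) =ᶠ[nhds t] fun _ => I.g t y := by
    filter_upwards [Iio_mem_nhds ht] with τ hτ using I.before τ (le_of_lt hτ) _
  unfold velocity
  rw [this.deriv_eq]; simp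

lemma velocity_of_gt {t : ℝ} (ht : I.T < t) : I.velocity t = 0 := by
  funext y
  have : (fun τ => I.f τ (I.g t y)) =ᶠ[nhds t] fun _ => I.f I.T (I.g t y) := by
    filter_upwards [Ioi_mem_nhds ht] with τ hτ using I.after τ (le_of_lt hτ) _
  unfold velocity
  rw [this.deriv_eq]; simp

lemma g_before {t : ℝ} (ht : t ≤ 0) (x : E n) : I.g t x = x := by
  conv_lhs => rw [← I.before t ht x]
  exact I.left_inv t x

/-- Running one isotopy after another. -/
def trans (J : Isotopy n) : Isotopy n where
  f t x := J.f (t - I.T) (I.f t x)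
  g t x := I.g t (J.g (t - I.T) x)
  T := I.T + J.T
  K := I.K ∪ J.K
  T_pos := add_pos I.T_pos J.T_pos
  smooth_f := J.smooth_f.comp ((contDiff_fst.sub contDiff_const).prodMk I.smooth_f)
  smooth_g := I.smooth_g.comp (contDiff_fst.prodMk
    (J.smooth_g.comp ((contDiff_fst.sub contDiff_const).prodMk contDiff_snd)))
  left_inv t x := by rw [J.left_inv, I.left_inv]
  right_inv t x := by rw [I.right_inv, J.right_inv]
  isCompact_K := I.isCompact_K.union J.isCompact_K
  K_subset := union_subset I.K_subset J.K_subset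
  eq_off t x hx := by
    rw [mem_union, not_or] at hx
    rw [I.eq_off t x hx.1, J.eq_off _ x hx.2]
  before t ht x := by
    rw [I.before t ht, J.before _ (by linarith [I.T_pos])]
  after t ht x := by
    rw [I.after t (by linarith [J.T_pos]), I.after (I.T + J.T) (by linarith [J.T_pos]),
      J.after _ (by linarith), add_sub_cancel_left]

lemma trans_velocity_of_lt (J : Isotopy n) {t : ℝ} (ht : t < I.T) :
    (I.trans J).velocity t = I.velocity t := by
  funext y
  have h1 : J.g (t - I.T) y = y := J.g_before (by linarith) y
  have : (fun τ => J.f (τ - I.T) (I.f τ (I.g t (J.g (t - I.T) y)))) =ᶠ[nhds t]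
      fun τ => I.f τ (I.g t y) := by
    filter_upwards [Iio_mem_nhds ht] with τ hτ
    rw [h1, J.before _ (by linarith [mem_Iio.1 hτ])]
  exact this.deriv_eq

lemma trans_velocity_of_gt (J : Isotopy n) {t : ℝ} (ht : I.T < t) :
    (I.trans J).velocity t = J.velocity (t - I.T) := by
  funext y
  have : (fun τ => J.f (τ - I.T) (I.f τ (I.g t (J.g (t - I.T) y)))) =ᶠ[nhds t]
      fun τ => J.f (τ - I.T) (J.g (t - I.T) y) := by
    filter_upwards [Ioi_mem_nhds ht] with τ hτ
    rw [I.after τ (le_of_lt hτ), ← I.after t ht.le, I.right_inv]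
  exact this.deriv_eq.trans (deriv_comp_sub_const (f := fun τ => J.f τ (J.g (t - I.T) y)) _ _)

/-- The velocity of the concatenation agrees with that of `I` before time `I.T` and with a time
shift of that of `J` afterwards; the single switching time is null. -/
lemma cost_trans_le (J : Isotopy n) (s p : ℝ) :
    (I.trans J).cost s p ≤ I.cost s p + J.cost s p := by
  unfold cost
  rw [← lintegral_add_compl _ (measurableSet_Iio (a := I.T)), compl_Iio,
    setLIntegral_congr Ioi_ae_eq_Ici.symm]
  refine add_le_add ?_ ?_
  · rw [setLIntegral_congr_fun measurableSet_Iio (fun t ht => by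
      rw [I.trans_velocity_of_lt J ht])]
    exact setLIntegral_le_lintegral _ _
  · rw [setLIntegral_congr_fun measurableSet_Ioi (fun t ht => by
      rw [I.trans_velocity_of_gt J ht])]
    refine (setLIntegral_le_lintegral _ _).trans_eq ?_
    exact lintegral_sub_right_eq_self (fun t => sobolevNorm s p (J.velocity t)) I.T

/-- The time reversal of an isotopy, ending at the inverse of its final map. -/
def symm : Isotopy n where
  f t x := I.f (I.T - t) (I.g I.T x)
  g t x := I.f I.T (I.g (I.T - t) x)
  T := I.T
  K := I.K
  T_pos := I.T_pos
  smooth_f := I.smooth_f.comp ((contDiff_const.sub contDiff_fst).prodMk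
    (I.smooth_g.comp (contDiff_const.prodMk contDiff_snd)))
  smooth_g := I.smooth_f.comp (contDiff_const.prodMk
    (I.smooth_g.comp ((contDiff_const.sub contDiff_fst).prodMk contDiff_snd)))
  left_inv t x := by rw [I.left_inv, I.right_inv]
  right_inv t x := by rw [I.left_inv, I.right_inv]
  isCompact_K := I.isCompact_K
  K_subset := I.K_subset
  eq_off t x hx := by rw [I.g_eq_off _ hx, I.eq_off _ x hx]
  before t ht x := by rw [I.after _ (by linarith), I.right_inv]
  after t ht x := by rw [I.before _ (by linarith), I.before _ (by linarith)]

lemma symm_velocity (t : ℝ) : I.symm.velocity t = fun y => (-1 : ℝ) • I.velocity (I.T - t) y := by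
  funext y
  have h1 : ∀ τ, I.f (I.T - τ) (I.g I.T (I.f I.T (I.g (I.T - t) y))) =
      I.f (I.T - τ) (I.g (I.T - t) y) := fun τ => by rw [I.left_inv]
  change deriv (fun τ => I.f (I.T - τ) (I.g I.T (I.f I.T (I.g (I.T - t) y)))) t = _
  simp_rw [h1]
  rw [deriv_comp_const_sub (f := fun τ => I.f τ (I.g (I.T - t) y)), neg_smul, one_smul]
  rfl

lemma contDiff_velocity_right (t : ℝ) : ContDiff ℝ ∞ (I.velocity t) :=
  I.contDiff_velocity.comp (contDiff_const.prodMk contDiff_id)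

lemma cost_symm {s p : ℝ} (hp : 1 < p) : I.symm.cost s p = I.cost s p := by
  unfold cost
  simp_rw [symm_velocity]
  have : ∀ t, sobolevNorm s p (fun y => (-1 : ℝ) • I.velocity (I.T - t) y) =
      sobolevNorm s p (I.velocity (I.T - t)) := fun t => by
    rw [sobolevNorm_const_smul hp _ (I.contDiff_velocity_right _)]; simp
  simp_rw [this]
  exact lintegral_sub_left_eq_self (fun t => sobolevNorm s p (I.velocity t)) I.T

end Isotopy

/-! ### Maps reached at a given cost: composition and inversion -/

/-- The map `φ` is the end of an isotopy of length at most `L`. -/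
def Reach {n : ℕ} (s p : ℝ) (L : ℝ≥0∞) (φ : E n → E n) : Prop :=
  ∃ I : Isotopy n, I.f I.T = φ ∧ I.cost s p ≤ L

lemma Reach.comp {n : ℕ} {s p : ℝ} {L M : ℝ≥0∞} {φ ψ : E n → E n} (h : Reach s p M ψ)
    (h' : Reach s p L φ) : Reach s p (L + M) (ψ ∘ φ) := by
  obtain ⟨I, hI, hIc⟩ := h'
  obtain ⟨J, hJ, hJc⟩ := h
  refine ⟨I.trans J, ?_, (I.cost_trans_le J s p).trans (add_le_add hIc hJc)⟩
  funext x
  change J.f (I.T + J.T - I.T) (I.f (I.T + J.T) x) = ψ (φ x)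
  rw [add_sub_cancel_left, I.after _ (by linarith [J.T_pos]), hI, hJ]

lemma Reach.inverse {n : ℕ} {s p : ℝ} (hp : 1 < p) {L : ℝ≥0∞} {φ ψ : E n → E n}
    (h : Reach s p L φ) (hψ : ∀ x, φ (ψ x) = x) : Reach s p L ψ := by
  obtain ⟨I, rfl, hc⟩ := h
  refine ⟨I.symm, ?_, (I.cost_symm hp).trans_le hc⟩
  funext x
  change I.f (I.T - I.T) (I.g I.T x) = ψ x
  rw [sub_self, I.before 0 le_rfl]
  conv_lhs => rw [← hψ x, I.left_inv]

lemma Reach.mono {n : ℕ} {s p : ℝ} {L M : ℝ≥0∞} {φ : E n → E n} (h : Reach s p L φ)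
    (hLM : L ≤ M) : Reach s p M φ := by
  obtain ⟨I, hI, hc⟩ := h
  exact ⟨I, hI, hc.trans hLM⟩

/-! ### Inverses of smooth families of maps -/

/-- Apply the inverse function theorem to `(t, x) ↦ (t, f t x)`. Its derivative is block triangular
with identity time block, so it is injective, hence invertible, as soon as the space block is
injective. -/
lemma contDiff_family_inverse {n : ℕ} {f g : ℝ → E n → E n}
    (hf : ContDiff ℝ ∞ fun q : ℝ × E n => f q.1 q.2) (hl : ∀ t x, g t (f t x) = x)
    (hr : ∀ t x, f t (g t x) = x) (hinj : ∀ t x, Function.Injective (fderiv ℝ (f t) x)) :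
    ContDiff ℝ ∞ fun q : ℝ × E n => g q.1 q.2 := by
  let F : ℝ × E n ≃ ℝ × E n :=
    { toFun := fun q => (q.1, f q.1 q.2)
      invFun := fun q => (q.1, g q.1 q.2)
      left_inv := fun q => by simp [hl]
      right_inv := fun q => by simp [hr] }
  have hF : ContDiff ℝ ∞ F := contDiff_fst.prodMk hf
  have hF' : ∀ q, ∃ A : (ℝ × E n) ≃L[ℝ] (ℝ × E n), HasFDerivAt F (A : (ℝ × E n) →L[ℝ] _) q := by
    intro q
    have hfq : HasFDerivAt (fun q : ℝ × E n => f q.1 q.2)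
        (fderiv ℝ (fun q : ℝ × E n => f q.1 q.2) q) q :=
      (hf.differentiable (by simp) q).hasFDerivAt
    set B := fderiv ℝ (fun q : ℝ × E n => f q.1 q.2) q with hB
    have hFq : HasFDerivAt F ((ContinuousLinearMap.fst ℝ ℝ (E n)).prod B) q :=
      hasFDerivAt_fst.prodMk hfq
    have hBx : ∀ v, B (0, v) = fderiv ℝ (f q.1) q.2 v := by
      intro v
      have h1 : HasFDerivAt (fun x : E n => (q.1, x)) (ContinuousLinearMap.inr ℝ ℝ (E n)) q.2 :=
        hasFDerivAt_prodMk_right q.1 q.2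
      have h2 : HasFDerivAt (f q.1) (B.comp (ContinuousLinearMap.inr ℝ ℝ (E n))) q.2 :=
        HasFDerivAt.comp (g := fun q : ℝ × E n => f q.1 q.2) q.2 hfq h1
      rw [h2.fderiv]; simp
    have hinjF : Function.Injective
        ((ContinuousLinearMap.fst ℝ ℝ (E n)).prod B : (ℝ × E n) →ₗ[ℝ] (ℝ × E n)) := by
      rw [← LinearMap.ker_eq_bot, LinearMap.ker_eq_bot']
      rintro ⟨a, v⟩ hv
      have ha : a = 0 := congrArg Prod.fst hv
      have hv2 : B (a, v) = 0 := congrArg Prod.snd hv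
      subst ha
      rw [hBx] at hv2
      have : v = 0 := hinj q.1 q.2 (by rw [hv2, map_zero])
      rw [this]; rfl
    refine ⟨(LinearEquiv.ofInjectiveEndo _ hinjF).toContinuousLinearEquiv, ?_⟩
    convert hFq using 1
    exact ContinuousLinearMap.ext fun v => rfl
  choose A hA using hF'
  have hopen : IsOpenMap F := isOpenMap_of_hasStrictFDerivAt_equiv (f' := A) fun q =>
    hF.contDiffAt.hasStrictFDerivAt' (hA q) (by simp)
  exact ((F.toHomeomorphOfContinuousOpen hF.continuous hopen).contDiff_symm hA hF).snd

/-! ### Displacement by a small field -/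

lemma sobolevNorm_zero {n : ℕ} {p s : ℝ} (hp : 1 < p) :
    sobolevNorm s p (0 : E n → E n) = 0 := by
  have h := sobolevNorm_const_smul (n := n) (s := s) hp 0 (V := fun _ => 0) contDiff_const
  simp only [zero_smul, enorm_zero, zero_mul] at h
  exact h

lemma Isotopy.cost_le {n : ℕ} (I : Isotopy n) {p s : ℝ} (hp : 1 < p) {c : ℝ≥0∞}
    (h : ∀ t, sobolevNorm s p (I.velocity t) ≤ c) : I.cost s p ≤ c * ENNReal.ofReal I.T := by
  have h1 : ∀ t, sobolevNorm s p (I.velocity t) ≤ (Icc 0 I.T).indicator (fun _ => c) t := by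
    intro t
    by_cases ht : t ∈ Icc 0 I.T
    · simpa [ht] using h t
    · rw [mem_Icc, not_and_or, not_le, not_le] at ht
      rcases ht with ht | ht
      · rw [I.velocity_of_neg ht, sobolevNorm_zero hp]; exact zero_le
      · rw [I.velocity_of_gt ht, sobolevNorm_zero hp]; exact zero_le
  refine (lintegral_mono h1).trans_eq ?_
  rw [lintegral_indicator_const measurableSet_Icc]; simp

lemma exists_deriv_smoothTransition_le : ∃ D : ℝ, 0 ≤ D ∧ ∀ t, |deriv Real.smoothTransition t| ≤ D := by
  have hc : Continuous (deriv Real.smoothTransition) :=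
    (Real.smoothTransition.contDiff (n := 1)).continuous_deriv le_rfl
  obtain ⟨D, hD⟩ := isCompact_Icc (a := (0 : ℝ)) (b := 1) |>.exists_bound_of_continuousOn
    hc.continuousOn
  refine ⟨max D 0, le_max_right _ _, fun t => ?_⟩
  by_cases ht : t ∈ Icc (0 : ℝ) 1
  · exact (hD t ht).trans (le_max_left _ _)
  · refine le_trans (le_of_eq ?_) (le_max_right _ _)
    rw [abs_eq_zero]
    rw [mem_Icc, not_and_or, not_le, not_le] at ht
    rcases ht with ht | ht
    · have : Real.smoothTransition =ᶠ[nhds t] fun _ => 0 := by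
        filter_upwards [Iio_mem_nhds ht] with τ hτ
          using Real.smoothTransition.zero_of_nonpos (le_of_lt hτ)
      rw [this.deriv_eq]; simp
    · have : Real.smoothTransition =ᶠ[nhds t] fun _ => 1 := by
        filter_upwards [Ioi_mem_nhds ht] with τ hτ
          using Real.smoothTransition.one_of_one_le (le_of_lt hτ)
      rw [this.deriv_eq]; simp

/-- If `W` is the Eulerian field of the displacement `x ↦ x + e U x`, then it inherits the bounds
of `U`. -/
lemma IsTame.displacement {n : ℕ} {M τ e : ℝ} (hM : 0 ≤ M) (hτ : 0 < τ) (he0 : 0 ≤ e) (he1 : e ≤ 1)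
    {U : E n → E n} (hU : IsTame M τ U) (hU2 : ∀ x, ‖fderiv ℝ U x‖ ≤ 1 / 2) {g : E n → E n}
    (hg : Differentiable ℝ g) (hl : ∀ x, g (x + e • U x) = x) (hr : ∀ x, g x + e • U (g x) = x) :
    IsTame (8 * M) τ (U ∘ g) := by
  have hge : ∀ y, g y = y - e • U (g y) := fun y => eq_sub_of_add_eq (hr y)
  have hUl : ∀ x y, ‖U x - U y‖ ≤ 1 / 2 * ‖x - y‖ := fun x y =>
    convex_univ.norm_image_sub_le_of_norm_fderiv_le (fun z _ => hU.differentiable z)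
      (fun z _ => hU2 z) (mem_univ y) (mem_univ x)
  have hgl : ∀ x y, ‖g x - g y‖ ≤ 2 * ‖x - y‖ := by
    intro x y
    have h1 : g x - g y = (x - y) - e • (U (g x) - U (g y)) := by
      conv_lhs => rw [hge x, hge y]
      rw [smul_sub]; abel
    have h2 : ‖g x - g y‖ ≤ ‖x - y‖ + 1 / 2 * ‖g x - g y‖ := by
      conv_lhs => rw [h1]
      refine (norm_sub_le _ _).trans (add_le_add le_rfl ?_)
      rw [norm_smul, Real.norm_of_nonneg he0]
      exact (mul_le_of_le_one_left (norm_nonneg _) he1).trans (hUl _ _)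
    linarith
  have hdiff : Differentiable ℝ (U ∘ g) := hU.differentiable.comp hg
  -- Differentiating `g y = y - e • U (g y)` gives an implicit equation for the derivative of `U ∘
  -- g`. The bound `1 / 2` on `fderiv ℝ U` lets every unknown term be absorbed on the left, so `1 +
  -- e DU` never has to be inverted.
  have hP : ∀ y, fderiv ℝ (U ∘ g) y = (fderiv ℝ U (g y)).comp
      (ContinuousLinearMap.id ℝ (E n) - e • fderiv ℝ (U ∘ g) y) := by
    intro y
    have h1 : HasFDerivAt g (ContinuousLinearMap.id ℝ (E n) - e • fderiv ℝ (U ∘ g) y) y := by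
      have h2 : HasFDerivAt (fun y => y - e • (U ∘ g) y)
          (ContinuousLinearMap.id ℝ (E n) - e • fderiv ℝ (U ∘ g) y) y :=
        (hasFDerivAt_id y).sub ((hdiff y).hasFDerivAt.const_smul e)
      exact h2.congr_of_eventuallyEq (.of_forall hge)
    exact ((hU.differentiable (g y)).hasFDerivAt.comp y h1).fderiv
  have hid : ‖ContinuousLinearMap.id ℝ (E n)‖ ≤ 1 := ContinuousLinearMap.norm_id_le
  have heP : ∀ L : E n →L[ℝ] E n, ‖e • L‖ ≤ ‖L‖ := fun L => by
    rw [norm_smul, Real.norm_of_nonneg he0]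
    exact mul_le_of_le_one_left (norm_nonneg _) he1
  have hPn : ∀ y, ‖fderiv ℝ (U ∘ g) y‖ ≤ 2 * ‖fderiv ℝ U (g y)‖ := by
    intro y
    have h1 : ‖fderiv ℝ (U ∘ g) y‖ ≤ ‖fderiv ℝ U (g y)‖ * (1 + ‖fderiv ℝ (U ∘ g) y‖) := by
      conv_lhs => rw [hP y]
      refine (ContinuousLinearMap.opNorm_comp_le _ _).trans ?_
      gcongr
      exact (norm_sub_le _ _).trans (add_le_add hid (heP _))
    have h2 := mul_le_mul_of_nonneg_right (hU2 (g y)) (norm_nonneg (fderiv ℝ (U ∘ g) y))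
    linarith
  have hP1 : ∀ y, ‖fderiv ℝ (U ∘ g) y‖ ≤ 1 := fun y => by linarith [hPn y, hU2 (g y)]
  have hPs : ∀ x y, ‖fderiv ℝ (U ∘ g) x - fderiv ℝ (U ∘ g) y‖ ≤
      4 * ‖fderiv ℝ U (g x) - fderiv ℝ U (g y)‖ := by
    intro x y
    set P := fderiv ℝ (U ∘ g) x
    set Q := fderiv ℝ (U ∘ g) y
    set A := fderiv ℝ U (g x)
    set B := fderiv ℝ U (g y)
    -- Subtracting two instances of the implicit equation: the last term has norm at most `‖P - Q‖ /
    -- 2` and is absorbed. With `‖id - e • P‖ ≤ 2` this gives the factor `4`; the Lipschitz constant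
    -- `2` of `g` then makes `8`.
    have h1 : P - Q = (A - B).comp (ContinuousLinearMap.id ℝ (E n) - e • P) -
        B.comp (e • (P - Q)) := by
      conv_lhs => rw [show P = _ from hP x, show Q = _ from hP y]
      ext v
      simp only [P, Q, A, B]
      simp [smul_sub]
      ring
    have h2 : ‖P - Q‖ ≤ ‖A - B‖ * 2 + 1 / 2 * ‖P - Q‖ := by
      conv_lhs => rw [h1]
      refine (norm_sub_le _ _).trans (add_le_add ?_ ?_)
      · refine (ContinuousLinearMap.opNorm_comp_le _ _).trans ?_
        gcongr
        refine (norm_sub_le _ _).trans ?_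
        linarith [heP P, hP1 x]
      · refine (ContinuousLinearMap.opNorm_comp_le _ _).trans ?_
        exact mul_le_mul (hU2 _) (heP _) (norm_nonneg _) (by norm_num)
    linarith
  refine ⟨fun x => (hU.norm_le _).trans (by gcongr; linarith), fun x => ?_, fun x y => ?_, hdiff, ?_⟩
  · linarith [hPn x, hU.norm_fderiv_le (g x)]
  · calc _ ≤ 4 * (M / τ * (2 * ‖x - y‖)) := by
          refine (hPs x y).trans ?_
          gcongr
          refine (hU.norm_fderiv_sub_le _ _).trans ?_
          gcongr
          exact hgl x y
      _ = _ := by ring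
  · obtain ⟨S, hS, hvol, hz⟩ := hU.exists_support
    refine ⟨S, hS, hvol.trans (ENNReal.ofReal_le_ofReal (by gcongr; linarith)), fun x hx => ?_⟩
    have := hl x
    rw [hz x hx, smul_zero, add_zero] at this
    rw [Function.comp_apply, this, hz x hx]

/-- `U` is `1 / 2`-Lipschitz, so each `x + η t • U x` is inverted by solving `x = y - η t • U x` as
a contraction fixed point. The smooth transition makes the path constant outside `[0, 1]`. -/
theorem exists_isotopy_displacement {n : ℕ} {U : E n → E n} (hU : ContDiff ℝ ∞ U)
    (hU2 : ∀ x, ‖fderiv ℝ U x‖ ≤ 1 / 2) {K : Set (E n)} (hK : IsCompact K)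
    (hKB : K ⊆ Metric.ball 0 1) (hz : ∀ x, x ∉ K → U x = 0) :
    ∃ I : Isotopy n, I.T = 1 ∧ I.f = fun t x => x + Real.smoothTransition t • U x := by
  have hd : Differentiable ℝ U := hU.differentiable (by simp)
  have hUl : ∀ x y, ‖U x - U y‖ ≤ 1 / 2 * ‖x - y‖ := fun x y =>
    convex_univ.norm_image_sub_le_of_norm_fderiv_le (fun z _ => hd z)
      (fun z _ => hU2 z) (mem_univ y) (mem_univ x)
  set η := Real.smoothTransition with hη
  have h0 : ∀ t, 0 ≤ η t := Real.smoothTransition.nonneg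
  have h1 : ∀ t, η t ≤ 1 := Real.smoothTransition.le_one
  have hl : ∀ t x y, ‖η t • U x - η t • U y‖ ≤ 1 / 2 * ‖x - y‖ := fun t x y => by
    rw [← smul_sub, norm_smul, Real.norm_of_nonneg (h0 t)]
    exact (mul_le_of_le_one_left (norm_nonneg _) (h1 t)).trans (hUl x y)
  have hcontr : ∀ t y, ContractingWith (1 / 2 : ℝ≥0) (fun x => y - η t • U x) := by
    intro t y
    refine ⟨by rw [← NNReal.coe_lt_coe]; norm_num, LipschitzWith.of_dist_le_mul fun a b => ?_⟩
    rw [dist_eq_norm, dist_eq_norm, sub_sub_sub_cancel_left, norm_sub_rev a b]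
    exact_mod_cast hl t b a
  let g : ℝ → E n → E n := fun t y => (hcontr t y).fixedPoint
  have hr : ∀ t x, g t x + η t • U (g t x) = x := fun t x => by
    have := (hcontr t x).fixedPoint_isFixedPt
    have h2 : x - η t • U (g t x) = g t x := this
    exact (eq_sub_iff_add_eq.1 h2.symm)
  have hli : ∀ t x, g t (x + η t • U x) = x := fun t x =>
    ((hcontr t (x + η t • U x)).fixedPoint_unique (x := x) (by
      simp [Function.IsFixedPt])).symm
  have hηs : ContDiff ℝ ∞ η := Real.smoothTransition.contDiff
  have hf : ContDiff ℝ ∞ fun q : ℝ × E n => q.2 + η q.1 • U q.2 :=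
    contDiff_snd.add ((hηs.comp contDiff_fst).smul (hU.comp contDiff_snd))
  refine ⟨⟨fun t x => x + η t • U x, g, 1, K, one_pos, hf, ?_, hli, hr, hK, hKB, ?_, ?_, ?_⟩, rfl,
    rfl⟩
  · refine contDiff_family_inverse (f := fun t x => x + η t • U x) hf hli hr fun t x => ?_
    have hD : HasFDerivAt (fun x => x + η t • U x)
        (ContinuousLinearMap.id ℝ (E n) + η t • fderiv ℝ U x) x :=
      (hasFDerivAt_id x).add ((hd x).hasFDerivAt.fun_const_smul (η t))
    rw [hD.fderiv]
    refine (injective_iff_map_eq_zero _).2 fun v hv => ?_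
    have hv' : v = -(η t • fderiv ℝ U x v) := eq_neg_of_add_eq_zero_left hv
    have h3 : ‖v‖ ≤ 1 / 2 * ‖v‖ := by
      conv_lhs => rw [hv']
      rw [norm_neg, norm_smul, Real.norm_of_nonneg (h0 t)]
      refine (mul_le_of_le_one_left (norm_nonneg _) (h1 t)).trans ?_
      exact (fderiv ℝ U x).le_of_opNorm_le (hU2 x) v
    exact norm_eq_zero.1 (by linarith [norm_nonneg v])
  · intro t x hx
    simp [hz x hx]
  · intro t ht x
    simp [hη, Real.smoothTransition.zero_of_nonpos ht]
  · intro t ht x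
    simp [hη, Real.smoothTransition.one_of_one_le ht]

/-- The velocity at time `t` is `η'(t)` times `U` composed with the inverse map at time `t`, which
is tame with constant `8 * M` by `IsTame.displacement`. -/
theorem exists_reach_displacement {n : ℕ} (hn : 1 ≤ n) {p s : ℝ} (hp : 1 < p) (hs0 : 0 ≤ s)
    (hs : s < 1 + 1 / p) {M : ℝ} (hM : 0 ≤ M) :
    ∃ C : ℝ, 0 ≤ C ∧ ∀ (τ : ℝ) (U : E n → E n), 0 < τ → τ ≤ 1 → IsTame M τ U → ContDiff ℝ ∞ U →
      (∀ x, ‖fderiv ℝ U x‖ ≤ 1 / 2) →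
      (∃ K : Set (E n), IsCompact K ∧ K ⊆ Metric.ball 0 1 ∧ ∀ x, x ∉ K → U x = 0) →
      Reach s p (ENNReal.ofReal (C * τ ^ (1 + 1 / p - s))) (fun x => x + U x) := by
  obtain ⟨C, hC, hCb⟩ := exists_sobolevNorm_le hn hp hs0 hs (M := 8 * M) (by positivity)
  obtain ⟨D, hD, hDb⟩ := exists_deriv_smoothTransition_le
  refine ⟨D * C, by positivity, fun τ U hτ hτ1 hU hUs hU2 ⟨K, hK, hKB, hz⟩ => ?_⟩
  obtain ⟨I, hT, hf⟩ := exists_isotopy_displacement hUs hU2 hK hKB hz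
  refine ⟨I, ?_, ?_⟩
  · rw [hT, hf]; simp
  have hvel : ∀ t, I.velocity t =
      fun y => deriv Real.smoothTransition t • (U ∘ I.g t) y := by
    intro t
    funext y
    have hη : HasDerivAt Real.smoothTransition (deriv Real.smoothTransition t) t :=
      ((Real.smoothTransition.contDiff (n := 1)).differentiable (by simp) t).hasDerivAt
    change deriv (fun τ => I.f τ (I.g t y)) t = _
    rw [hf]
    exact ((hη.smul_const (U (I.g t y))).const_add (I.g t y)).deriv
  have hgs : ∀ t, ContDiff ℝ ∞ (I.g t) := fun t =>
    I.smooth_g.comp (contDiff_const.prodMk contDiff_id)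
  refine (I.cost_le hp (c := ENNReal.ofReal (D * C * τ ^ (1 + 1 / p - s))) fun t => ?_).trans_eq
    (by rw [hT]; simp)
  rw [hvel, sobolevNorm_const_smul hp _ (hUs.comp (hgs t)), mul_assoc, ENNReal.ofReal_mul hD,
    ← ofReal_norm]
  gcongr
  · exact hDb t
  · refine hCb τ _ hτ hτ1 (IsTame.displacement (e := Real.smoothTransition t) hM hτ
      (Real.smoothTransition.nonneg t) (Real.smoothTransition.le_one t) hU hU2
      ((hgs t).differentiable (by simp)) ?_ ?_)
    · intro x; have := I.left_inv t x; rwa [hf] at this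
    · intro x; have := I.right_inv t x; rwa [hf] at this

/-! ### Scaled fields -/

lemma volume_closedBall_le {n : ℕ} (hn : 1 ≤ n) {τ : ℝ} (hτ : 0 < τ) (hτ1 : τ ≤ 1) :
    volume (Metric.closedBall (0 : E n) τ) ≤
      ENNReal.ofReal (volume.real (Metric.ball (0 : E n) 1) * τ) := by
  rw [Measure.addHaar_closedBall _ _ hτ.le, mul_comm, ENNReal.ofReal_mul measureReal_nonneg,
    ofReal_measureReal (by exact measure_ball_lt_top.ne)]
  gcongr
  simp only [finrank_euclideanSpace, Fintype.card_fin]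
  calc τ ^ n ≤ τ ^ 1 := pow_le_pow_of_le_one hτ.le hτ1 hn
    _ = τ := pow_one τ

/-- The rescaling `τ • V (τ⁻¹ • x)` preserves first derivatives and multiplies their Lipschitz
constant by `τ⁻¹`. The support shrinks to a ball of volume `O(τ ^ n)`, which is `O(τ)` because `n ≥
1` and `τ ≤ 1`. -/
lemma IsTame.scale {n : ℕ} (hn : 1 ≤ n) {M τ : ℝ} (hM : 0 ≤ M) (hτ : 0 < τ) (hτ1 : τ ≤ 1)
    {V : E n → E n} (hV : Differentiable ℝ V) (h0 : ∀ x, ‖V x‖ ≤ M) (h1 : ∀ x, ‖fderiv ℝ V x‖ ≤ M)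
    (h2 : ∀ x y, ‖fderiv ℝ V x - fderiv ℝ V y‖ ≤ M * ‖x - y‖)
    (hz : ∀ x, x ∉ Metric.closedBall (0 : E n) 1 → V x = 0) :
    IsTame (M + volume.real (Metric.ball (0 : E n) 1)) τ (fun x => τ • V (τ⁻¹ • x)) ∧
      ∀ x, fderiv ℝ (fun x => τ • V (τ⁻¹ • x)) x = fderiv ℝ V (τ⁻¹ • x) := by
  have hω : 0 ≤ volume.real (Metric.ball (0 : E n) 1) := measureReal_nonneg
  have hD : ∀ x, HasFDerivAt (fun x => τ • V (τ⁻¹ • x)) (fderiv ℝ V (τ⁻¹ • x)) x := by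
    intro x
    have e := (((hV (τ⁻¹ • x)).hasFDerivAt.comp x
      ((hasFDerivAt_id x).fun_const_smul τ⁻¹)).fun_const_smul τ)
    have e2 : τ • (fderiv ℝ V (τ⁻¹ • x)).comp (τ⁻¹ • ContinuousLinearMap.id ℝ (E n)) =
        fderiv ℝ V (τ⁻¹ • x) := by
      refine ContinuousLinearMap.ext fun v => ?_
      simp [smul_smul, hτ.ne']
    rw [e2] at e
    exact e
  refine ⟨⟨fun x => ?_, fun x => ?_, fun x y => ?_, fun x => (hD x).differentiableAt, ?_⟩,
    fun x => (hD x).fderiv⟩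
  · rw [norm_smul, Real.norm_of_nonneg hτ.le, mul_comm]
    gcongr
    linarith [h0 (τ⁻¹ • x)]
  · rw [(hD x).fderiv]; linarith [h1 (τ⁻¹ • x)]
  · rw [(hD x).fderiv, (hD y).fderiv]
    refine (h2 _ _).trans ?_
    rw [← smul_sub, norm_smul, Real.norm_of_nonneg (by positivity), ← mul_assoc, ← div_eq_mul_inv]
    gcongr
    linarith
  · refine ⟨Metric.closedBall 0 τ, Metric.isClosed_closedBall,
      (volume_closedBall_le hn hτ hτ1).trans (ENNReal.ofReal_le_ofReal ?_), fun x hx => ?_⟩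
    · gcongr; linarith
    · rw [hz, smul_zero]
      rw [mem_closedBall_zero_iff, not_le] at hx ⊢
      rw [norm_smul, Real.norm_of_nonneg (by positivity), ← div_eq_inv_mul, one_lt_div hτ]
      exact hx

lemma exists_bounds_of_hasCompactSupport {F G : Type*} [NormedAddCommGroup F] [NormedSpace ℝ F]
    [NormedAddCommGroup G] [NormedSpace ℝ G] {V : F → G} (hV : ContDiff ℝ ∞ V)
    (hc : HasCompactSupport V) :
    ∃ M : ℝ, 0 ≤ M ∧ (∀ x, ‖V x‖ ≤ M) ∧ (∀ x, ‖fderiv ℝ V x‖ ≤ M) ∧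
      ∀ x y, ‖fderiv ℝ V x - fderiv ℝ V y‖ ≤ M * ‖x - y‖ := by
  obtain ⟨A, hA⟩ := hc.exists_bound_of_continuous hV.continuous
  have hV' : ContDiff ℝ ∞ (fderiv ℝ V) := hV.fderiv_right (by simp)
  obtain ⟨B, hB⟩ := (hc.fderiv ℝ).exists_bound_of_continuous hV'.continuous
  obtain ⟨D, hD⟩ := hV'.lipschitzWith_of_hasCompactSupport (hc.fderiv ℝ) (by simp)
  refine ⟨max (max A B) D, le_max_of_le_right D.2, fun x => (hA x).trans (by simp),
    fun x => (hB x).trans (by simp), fun x y => ?_⟩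
  have := hD.dist_le_mul x y
  rw [dist_eq_norm, dist_eq_norm] at this
  exact this.trans (by gcongr; exact le_max_right _ _)

/-! ### Composing small displacements -/

lemma reach_id {n : ℕ} {p s : ℝ} (hp : 1 < p) : Reach s p 0 (fun x : E n => x) := by
  obtain ⟨I, hT, hf⟩ := exists_isotopy_displacement (U := fun _ : E n => 0) contDiff_const
    (by simp) isCompact_empty (empty_subset _) (by simp)
  refine ⟨I, by rw [hf]; simp, ?_⟩
  refine (I.cost_le hp (c := 0) fun t => ?_).trans_eq (zero_mul _)
  have : I.velocity t = 0 := by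
    funext y
    unfold Isotopy.velocity
    rw [hf]; simp
  rw [this, sobolevNorm_zero hp]

lemma ofReal_mul_geom_sum_le {C r : ℝ} (hC : 0 ≤ C) (hr : 0 ≤ r) (hr1 : r < 1) (J : ℕ) :
    ENNReal.ofReal (C * ∑ j ∈ Finset.range J, r ^ j) ≤ ENNReal.ofReal (C * (1 - r)⁻¹) := by
  apply ENNReal.ofReal_le_ofReal
  gcongr
  rw [← tsum_geometric_of_lt_one hr hr1]
  exact (summable_geometric_of_lt_one hr hr1).sum_le_tsum _ fun j _ => by positivity

/-- Compress a ball linearly into a small ball, at bounded cost. -/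
theorem exists_reach_linear_compression {n : ℕ} (hn : 1 ≤ n) {p s : ℝ} (hp : 1 < p) (hs0 : 0 ≤ s)
    (hs : s < 1 + 1 / p) :
    ∃ L q : ℝ, 0 < q ∧ q < 1 ∧ ∀ J : ℕ, ∃ ψ : E n → E n, Reach s p (ENNReal.ofReal L) ψ ∧
      ∀ x, ‖x‖ ^ 2 ≤ 1 / 2 → ψ x = q ^ J • x := by
  -- Equal to `x` on `‖x‖ ^ 2 ≤ 1 / 2` and to `0` once `‖x‖ ^ 2 ≥ 3 / 4`; so `x - c • W x` is
  -- multiplication by `q = 1 - c` on the inner ball.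
  let W : E n → E n := fun x => Real.smoothTransition (3 - 4 * ‖x‖ ^ 2) • x
  have hW : ContDiff ℝ ∞ W := (Real.smoothTransition.contDiff.comp
    (contDiff_const.sub (contDiff_const.mul (contDiff_norm_sq ℝ)))).smul contDiff_id
  let K : Set (E n) := {x | ‖x‖ ^ 2 ≤ 3 / 4}
  have hK1 : K ⊆ Metric.ball 0 1 := fun x hx => by
    rw [mem_ball_zero_iff]
    have : ‖x‖ ^ 2 ≤ 3 / 4 := hx
    nlinarith [norm_nonneg x]
  have hKc : IsCompact K := Metric.isCompact_of_isClosed_isBounded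
    (isClosed_le (by fun_prop) (by fun_prop)) (Metric.isBounded_ball.subset hK1)
  have hWz : ∀ x, x ∉ K → W x = 0 := fun x hx => by
    have : 3 / 4 < ‖x‖ ^ 2 := not_le.1 hx
    simp only [W]
    rw [Real.smoothTransition.zero_of_nonpos (by linarith), zero_smul]
  obtain ⟨M, hM, hb0, hb1, hb2⟩ := exists_bounds_of_hasCompactSupport hW
    (HasCompactSupport.intro hKc hWz)
  -- Small enough that the displacement field has derivative at most `1 / 2`.
  set c : ℝ := 1 / (2 * (M + 1)) with hc
  have hc0 : 0 < c := by positivity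
  have hcM : c * M ≤ 1 / 2 := by
    rw [hc, div_mul_eq_mul_div, div_le_div_iff₀ (by positivity) (by positivity)]; linarith
  have hc1 : c ≤ 1 / 2 := by
    rw [hc, div_le_div_iff₀ (by positivity) (by positivity)]; linarith
  let V : E n → E n := fun x => (-c) • W x
  have hV : ContDiff ℝ ∞ V := hW.const_smul (-c)
  have hVD : ∀ x, fderiv ℝ V x = (-c) • fderiv ℝ W x := fun x =>
    fderiv_fun_const_smul (hW.differentiable (by simp) x) _
  have hcn : ‖-c‖ = c := by rw [norm_neg, Real.norm_of_nonneg hc0.le]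
  have hcM' : ∀ a, a ≤ M → 0 ≤ a → c * a ≤ M := fun a ha ha0 =>
    (mul_le_of_le_one_left ha0 (by linarith)).trans ha
  have hV2 : ∀ x, ‖fderiv ℝ V x‖ ≤ 1 / 2 := fun x => by
    rw [hVD, norm_smul, hcn]
    exact (mul_le_mul_of_nonneg_left (hb1 x) hc0.le).trans hcM
  have hVz : ∀ x, x ∉ K → V x = 0 := fun x hx => by simp [V, hWz x hx]
  have hVt := fun (τ : ℝ) (hτ : 0 < τ) (hτ1 : τ ≤ 1) => IsTame.scale hn hM hτ hτ1 (V := V)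
    (hV.differentiable (by simp))
    (fun x => by simp only [V]; rw [norm_smul, hcn]; exact hcM' _ (hb0 x) (norm_nonneg _))
    (fun x => by rw [hVD, norm_smul, hcn]; exact hcM' _ (hb1 x) (norm_nonneg _))
    (fun x y => by
      have e : (-c) • fderiv ℝ W x - (-c) • fderiv ℝ W y =
        (-c) • (fderiv ℝ W x - fderiv ℝ W y) := (smul_sub _ _ _).symm
      rw [hVD, hVD, e, norm_smul, hcn]
      exact (mul_le_of_le_one_left (norm_nonneg _) (by linarith)).trans (hb2 x y))
    (fun x hx => hVz x fun h => hx (Metric.ball_subset_closedBall (hK1 h)))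
  obtain ⟨C, hC, hR⟩ := exists_reach_displacement (n := n) hn hp hs0 hs
    (M := M + volume.real (Metric.ball (0 : E n) 1)) (by positivity)
  have hε : 0 < 1 + 1 / p - s := by linarith
  set ε := 1 + 1 / p - s
  set q := 1 - c with hq
  have hq0 : 0 < q := by linarith
  have hq1 : q < 1 := by linarith
  refine ⟨C * (1 - q ^ ε)⁻¹, q, hq0, hq1, fun J => ?_⟩
  have hr0 : 0 ≤ q ^ ε := by positivity
  have hr1 : q ^ ε < 1 := Real.rpow_lt_one hq0.le hq1 hε
  suffices h : ∃ ψ : E n → E n,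
      Reach s p (ENNReal.ofReal (C * ∑ j ∈ Finset.range J, (q ^ ε) ^ j)) ψ ∧
      ∀ x, ‖x‖ ^ 2 ≤ 1 / 2 → ψ x = q ^ J • x by
    obtain ⟨ψ, h1, h2⟩ := h
    exact ⟨ψ, h1.mono (ofReal_mul_geom_sum_le hC hr0 hr1 J), h2⟩
  induction J with
  | zero => exact ⟨fun x => x, by simpa using reach_id hp, fun x _ => by simp⟩
  | succ J ih =>
    obtain ⟨ψ, h1, h2⟩ := ih
    have hτ : 0 < q ^ J := by positivity
    have hτ1 : q ^ J ≤ 1 := pow_le_one₀ hq0.le hq1.le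
    obtain ⟨ht, hD⟩ := hVt (q ^ J) hτ hτ1
    -- The next step is the same displacement at scale `q ^ J`. It multiplies by `q` on the ball of
    -- radius squared `q ^ (2 * J) / 2`, which is where the previous map has sent the inner ball.
    have h3 := hR (q ^ J) _ hτ hτ1 ht
      ((hV.comp (contDiff_id.const_smul (q ^ J)⁻¹)).const_smul (q ^ J))
      (fun x => by rw [hD]; exact hV2 _)
      ⟨K, hKc, hK1, fun x hx => by
        rw [hVz, smul_zero]
        intro h
        apply hx
        have h4 : ‖(q ^ J)⁻¹ • x‖ ^ 2 ≤ 3 / 4 := h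
        refine le_trans ?_ h4
        rw [norm_smul, Real.norm_of_nonneg (by positivity)]
        gcongr
        exact le_mul_of_one_le_left (norm_nonneg _) ((one_le_inv₀ hτ).2 hτ1)⟩
    refine ⟨_, (h3.comp h1).mono (le_of_eq ?_), fun x hx => ?_⟩
    · rw [← ENNReal.ofReal_add (by positivity) (by positivity), Finset.sum_range_succ, mul_add,
        Real.rpow_pow_comm hq0.le ε J]
    · rw [Function.comp_apply, h2 x hx, inv_smul_smul₀ hτ.ne']
      simp only [V, W]
      rw [Real.smoothTransition.one_of_one_le (by linarith), one_smul, smul_smul, ← add_smul]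
      congr 1
      rw [pow_succ, hq]; ring

/-! ### Pushing away from the boundary sphere -/

/-- A smooth bump that is `1` on `[1/2, 1]` and vanishes off `[1/4, 2]`. -/
def shellBump (z : ℝ) : ℝ := Real.smoothTransition (4 * z - 1) * Real.smoothTransition (2 - z)

lemma contDiff_shellBump : ContDiff ℝ ∞ shellBump :=
  (Real.smoothTransition.contDiff.comp ((contDiff_const.mul contDiff_id).sub contDiff_const)).mul
    (Real.smoothTransition.contDiff.comp (contDiff_const.sub contDiff_id))

lemma shellBump_eq_zero {z : ℝ} (hz : z ∉ Icc (1 / 4 : ℝ) 2) : shellBump z = 0 := by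
  rw [mem_Icc, not_and_or, not_le, not_le] at hz
  unfold shellBump
  rcases hz with h | h
  · rw [Real.smoothTransition.zero_of_nonpos (by linarith), zero_mul]
  · rw [Real.smoothTransition.zero_of_nonpos (x := 2 - z) (by linarith), mul_zero]

lemma shellBump_eq_one {z : ℝ} (h1 : 1 / 2 ≤ z) (h2 : z ≤ 1) : shellBump z = 1 := by
  unfold shellBump
  rw [Real.smoothTransition.one_of_one_le (by linarith),
    Real.smoothTransition.one_of_one_le (by linarith), one_mul]

lemma shellBump_nonneg (z : ℝ) : 0 ≤ shellBump z :=
  mul_nonneg (Real.smoothTransition.nonneg _) (Real.smoothTransition.nonneg _)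

lemma shellBump_le_one (z : ℝ) : shellBump z ≤ 1 :=
  mul_le_one₀ (Real.smoothTransition.le_one _) (Real.smoothTransition.nonneg _)
    (Real.smoothTransition.le_one _)

lemma exists_shellBump_bounds : ∃ B : ℝ, 1 ≤ B ∧ (∀ z, |deriv shellBump z| ≤ B) ∧
    (∀ z w, |shellBump z - shellBump w| ≤ B * |z - w|) ∧
    ∀ z w, |deriv shellBump z - deriv shellBump w| ≤ B * |z - w| := by
  have hc : HasCompactSupport shellBump :=
    HasCompactSupport.intro isCompact_Icc fun z hz => shellBump_eq_zero hz
  have h' : ContDiff ℝ ∞ (deriv shellBump) :=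
    (contDiff_infty_iff_deriv.1 contDiff_shellBump).2
  obtain ⟨A, hA⟩ := hc.deriv.exists_bound_of_continuous h'.continuous
  obtain ⟨D, hD⟩ := contDiff_shellBump.lipschitzWith_of_hasCompactSupport hc (by simp)
  obtain ⟨D', hD'⟩ := h'.lipschitzWith_of_hasCompactSupport hc.deriv (by simp)
  refine ⟨max (max 1 A) (max D D'), by simp, fun z => (hA z).trans (by simp), fun z w => ?_,
    fun z w => ?_⟩
  · exact (hD.dist_le_mul z w).trans (by rw [Real.dist_eq]; gcongr; simp)
  · exact (hD'.dist_le_mul z w).trans (by rw [Real.dist_eq]; gcongr; simp)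

/-- The radial field `x` cut off to the shell `1 - |x|² ∈ [τ/4, 2τ]`. -/
def shellField {n : ℕ} (τ : ℝ) (x : E n) : E n := shellBump ((1 - ‖x‖ ^ 2) / τ) • x

lemma contDiff_shellField {n : ℕ} (τ : ℝ) : ContDiff ℝ ∞ (shellField (n := n) τ) :=
  (contDiff_shellBump.comp ((contDiff_const.sub (contDiff_norm_sq ℝ)).div_const τ)).smul contDiff_id

/-- The derivative of `shellField`. -/
def shellDeriv {n : ℕ} (τ : ℝ) (x : E n) : E n →L[ℝ] E n :=
  shellBump ((1 - ‖x‖ ^ 2) / τ) • ContinuousLinearMap.id ℝ (E n) +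
    (-(2 / τ) * deriv shellBump ((1 - ‖x‖ ^ 2) / τ)) • (innerSL ℝ x).smulRight x

lemma hasFDerivAt_shellField {n : ℕ} (τ : ℝ) (x : E n) :
    HasFDerivAt (shellField τ) (shellDeriv τ x) x := by
  have h1 : HasFDerivAt (fun x : E n => ‖x‖ ^ 2) (2 • innerSL ℝ x) x :=
    (hasStrictFDerivAt_norm_sq x).hasFDerivAt
  have h2 : HasFDerivAt (fun x : E n => (1 - ‖x‖ ^ 2) / τ) (τ⁻¹ • -((2 : ℕ) • (innerSL ℝ x : E n →L[ℝ] ℝ))) x := by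
    have := (h1.const_sub 1).fun_const_smul τ⁻¹
    simpa [div_eq_inv_mul] using this
  have h3 : HasDerivAt shellBump (deriv shellBump ((1 - ‖x‖ ^ 2) / τ)) ((1 - ‖x‖ ^ 2) / τ) :=
    (contDiff_shellBump.differentiable (by simp) _).hasDerivAt
  have h4 := (h3.comp_hasFDerivAt x h2).fun_smul (hasFDerivAt_id x)
  have e : shellDeriv τ x = shellBump ((1 - ‖x‖ ^ 2) / τ) • ContinuousLinearMap.id ℝ (E n) +
        (deriv shellBump ((1 - ‖x‖ ^ 2) / τ) • (τ⁻¹ • -((2 : ℕ) • (innerSL ℝ x : E n →L[ℝ] ℝ)))).smulRight x := by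
    refine ContinuousLinearMap.ext fun v => ?_
    simp only [shellDeriv, add_apply, smul_apply, ContinuousLinearMap.smulRight_apply,
      smul_smul, smul_eq_mul, neg_apply]
    congr 2
    simp
    ring
  rw [e]
  exact h4

lemma shellField_eq_zero {n : ℕ} {τ : ℝ} {x : E n}
    (hx : (1 - ‖x‖ ^ 2) / τ ∉ Icc (1 / 4 : ℝ) 2) : shellField τ x = 0 := by
  rw [shellField, shellBump_eq_zero hx, zero_smul]

lemma norm_smulRight_inner_sub_le {n : ℕ} {x y : E n} (hx : ‖x‖ ≤ 1) (hy : ‖y‖ ≤ 1) :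
    ‖(innerSL ℝ x).smulRight x - (innerSL ℝ y).smulRight y‖ ≤ 2 * ‖x - y‖ := by
  have e : (innerSL ℝ x).smulRight x - (innerSL ℝ y).smulRight y =
      (innerSL ℝ (x - y)).smulRight x + (innerSL ℝ y).smulRight (x - y) := by
    refine ContinuousLinearMap.ext fun v => ?_
    simp [sub_smul, smul_sub]
  rw [e]
  refine (norm_add_le _ _).trans ?_
  rw [ContinuousLinearMap.norm_smulRight_apply, ContinuousLinearMap.norm_smulRight_apply,
    innerSL_apply_norm, innerSL_apply_norm]
  nlinarith [norm_nonneg (x - y)]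

/-- The cutoff varies across a shell of thickness comparable to `τ`, whence the factor `1 / τ`;
multiplying the field by a small multiple of `τ` later makes this `O(1)`. -/
lemma norm_shellDeriv_le {n : ℕ} {τ B : ℝ} (hτ : 0 < τ) (hτ1 : τ ≤ 1) (hB : 1 ≤ B)
    (hB1 : ∀ z, |deriv shellBump z| ≤ B) {x : E n} (hx : ‖x‖ ≤ 1) :
    ‖shellDeriv τ x‖ ≤ 3 * B / τ := by
  refine (norm_add_le _ _).trans ?_
  rw [norm_smul, norm_smul, ContinuousLinearMap.norm_smulRight_apply, innerSL_apply_norm,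
    Real.norm_of_nonneg (shellBump_nonneg _), norm_mul, norm_neg,
    Real.norm_of_nonneg (by positivity : 0 ≤ 2 / τ), Real.norm_eq_abs]
  have h1 : shellBump ((1 - ‖x‖ ^ 2) / τ) * ‖ContinuousLinearMap.id ℝ (E n)‖ ≤ B / τ := by
    have := mul_le_one₀ (shellBump_le_one ((1 - ‖x‖ ^ 2) / τ)) (norm_nonneg _)
      (ContinuousLinearMap.norm_id_le (𝕜 := ℝ) (E := E n))
    refine this.trans ?_
    rw [le_div_iff₀ hτ]; linarith
  have h2 : 2 / τ * |deriv shellBump ((1 - ‖x‖ ^ 2) / τ)| * (‖x‖ * ‖x‖) ≤ 2 / τ * B * 1 := by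
    gcongr
    · exact hB1 _
    · nlinarith [norm_nonneg x]
  calc _ ≤ B / τ + 2 / τ * B * 1 := add_le_add h1 h2
    _ = _ := by ring

lemma norm_shellDeriv_sub_le {n : ℕ} {τ B : ℝ} (hτ : 0 < τ) (hτ1 : τ ≤ 1) (hB : 1 ≤ B)
    (hB1 : ∀ z, |deriv shellBump z| ≤ B) (hB2 : ∀ z w, |shellBump z - shellBump w| ≤ B * |z - w|)
    (hB3 : ∀ z w, |deriv shellBump z - deriv shellBump w| ≤ B * |z - w|) {x y : E n}
    (hx : ‖x‖ ≤ 1) (hy : ‖y‖ ≤ 1) :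
    ‖shellDeriv τ x - shellDeriv τ y‖ ≤ 10 * B / τ ^ 2 * ‖x - y‖ := by
  set z := (1 - ‖x‖ ^ 2) / τ with hz
  set w := (1 - ‖y‖ ^ 2) / τ with hw
  have hzw : |z - w| ≤ 2 / τ * ‖x - y‖ := by
    have h1 : z - w = (‖x‖ + ‖y‖) / τ * (‖y‖ - ‖x‖) := by rw [hz, hw]; ring
    rw [h1, abs_mul, abs_of_nonneg (by positivity)]
    gcongr
    · linarith
    · rw [norm_sub_rev]; exact abs_norm_sub_norm_le y x
  have e : shellDeriv τ x - shellDeriv τ y =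
      (shellBump z - shellBump w) • ContinuousLinearMap.id ℝ (E n) +
      ((-(2 / τ) * (deriv shellBump z - deriv shellBump w)) • (innerSL ℝ x).smulRight x +
      (-(2 / τ) * deriv shellBump w) •
        ((innerSL ℝ x).smulRight x - (innerSL ℝ y).smulRight y)) := by
    refine ContinuousLinearMap.ext fun v => ?_
    simp only [shellDeriv, ← hz, ← hw, sub_apply, add_apply, smul_apply]
    module
  rw [e]
  have h2τ : ‖-(2 / τ)‖ = 2 / τ := by rw [norm_neg, Real.norm_of_nonneg (by positivity)]
  have hid := ContinuousLinearMap.norm_id_le (𝕜 := ℝ) (E := E n)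
  have b1 : ‖(shellBump z - shellBump w) • ContinuousLinearMap.id ℝ (E n)‖ ≤
      B * (2 / τ * ‖x - y‖) * 1 := by
    rw [norm_smul, Real.norm_eq_abs]
    gcongr
    exact (hB2 z w).trans (by gcongr)
  have b2 : ‖(-(2 / τ) * (deriv shellBump z - deriv shellBump w)) • (innerSL ℝ x).smulRight x‖ ≤
      2 / τ * (B * (2 / τ * ‖x - y‖)) * 1 := by
    rw [norm_smul, norm_mul, h2τ, Real.norm_eq_abs, ContinuousLinearMap.norm_smulRight_apply,
      innerSL_apply_norm]
    gcongr
    · exact (hB3 z w).trans (by gcongr)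
    · nlinarith [norm_nonneg x]
  have b3 : ‖(-(2 / τ) * deriv shellBump w) •
      ((innerSL ℝ x).smulRight x - (innerSL ℝ y).smulRight y)‖ ≤
      2 / τ * B * (2 * ‖x - y‖) := by
    rw [norm_smul, norm_mul, h2τ, Real.norm_eq_abs]
    gcongr
    · exact hB1 w
    · exact norm_smulRight_inner_sub_le hx hy
  refine (norm_add_le _ _).trans ((add_le_add b1 ((norm_add_le _ _).trans (add_le_add b2 b3))).trans
    ?_)
  have h3 : 1 / τ ≤ 1 / τ ^ 2 := by
    apply one_div_le_one_div_of_le (by positivity)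
    nlinarith
  have h4 := mul_le_mul_of_nonneg_left h3 (by positivity : 0 ≤ 6 * B * ‖x - y‖)
  calc _ = 6 * B * ‖x - y‖ * (1 / τ) + 4 * B * ‖x - y‖ * (1 / τ ^ 2) := by ring
    _ ≤ 6 * B * ‖x - y‖ * (1 / τ ^ 2) + 4 * B * ‖x - y‖ * (1 / τ ^ 2) := by linarith
    _ = _ := by ring

/-- The shell lies between radii `1 - 2 * τ` and `1`, and Bernoulli's inequality gives `1 - (1 - 2 *
τ) ^ n ≤ 2 * n * τ`. This linear volume bound yields the gain `1 / p`. -/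
lemma volume_shell_le {n : ℕ} (hn : 1 ≤ n) {τ : ℝ} (hτ : 0 < τ) (hτ1 : τ ≤ 1 / 2) :
    volume {x : E n | (1 - ‖x‖ ^ 2) / τ ∈ Icc (1 / 4 : ℝ) 2} ≤
      ENNReal.ofReal (2 * n * volume.real (Metric.ball (0 : E n) 1) * τ) := by
  have : Nontrivial (E n) := by
    apply Module.nontrivial_of_finrank_pos (R := ℝ)
    simp; omega
  set r := 1 - 2 * τ with hr
  have hr0 : 0 ≤ r := by linarith
  set v := volume.real (Metric.ball (0 : E n) 1) with hv
  have hv0 : 0 ≤ v := measureReal_nonneg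
  have hsub : {x : E n | (1 - ‖x‖ ^ 2) / τ ∈ Icc (1 / 4 : ℝ) 2} ⊆
      Metric.ball 0 1 \ Metric.ball 0 r := by
    intro x hx
    obtain ⟨h1, h2⟩ := hx
    rw [le_div_iff₀ hτ] at h1
    rw [div_le_iff₀ hτ] at h2
    rw [mem_sdiff, mem_ball_zero_iff, mem_ball_zero_iff, not_lt]
    constructor
    · nlinarith [norm_nonneg x]
    · by_contra! h
      nlinarith [norm_nonneg x]
  have hrr : volume (Metric.ball (0 : E n) r) = ENNReal.ofReal (r ^ n * v) := by
    rw [Measure.addHaar_ball _ _ hr0, ENNReal.ofReal_mul (by positivity),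
      ofReal_measureReal (by exact measure_ball_lt_top.ne)]
    simp
  have h11 : volume (Metric.ball (0 : E n) 1) = ENNReal.ofReal v :=
    (ofReal_measureReal (by exact measure_ball_lt_top.ne)).symm
  refine (measure_mono hsub).trans ?_
  rw [measure_sdiff (Metric.ball_subset_ball (by linarith)) measurableSet_ball.nullMeasurableSet
    measure_ball_lt_top.ne, h11, hrr, ← ENNReal.ofReal_sub _ (by positivity)]
  apply ENNReal.ofReal_le_ofReal
  have hbern : 1 + (n : ℝ) * (-(2 * τ)) ≤ (1 + -(2 * τ)) ^ n :=
    one_add_mul_le_pow (by linarith) n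
  rw [← sub_eq_add_neg] at hbern
  nlinarith

lemma shellField_isTame {n : ℕ} (hn : 1 ≤ n) : ∃ M c : ℝ, 0 ≤ M ∧ 0 < c ∧ c ≤ 1 ∧
    ∀ τ : ℝ, 0 < τ → τ ≤ 1 / 2 → IsTame M τ (fun x : E n => (-(c * τ)) • shellField τ x) ∧
      ∀ x, ‖fderiv ℝ (fun x : E n => (-(c * τ)) • shellField τ x) x‖ ≤ 1 / 2 := by
  obtain ⟨B, hB, hB1, hB2, hB3⟩ := exists_shellBump_bounds
  set v := volume.real (Metric.ball (0 : E n) 1) with hv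
  have hv0 : 0 ≤ v := measureReal_nonneg
  -- The value of `c` turns `c * τ * (3 * B / τ)` into exactly `1 / 2`.
  refine ⟨24 * B + 2 * n * v, 1 / (6 * B), by positivity, by positivity, ?_, ?_⟩
  · rw [div_le_one (by positivity)]; linarith
  intro τ hτ hτ1
  set c := 1 / (6 * B) with hc
  have hc0 : 0 < c := by positivity
  have hcB : c * B = 1 / 6 := by rw [hc]; field_simp
  have hc1 : c ≤ 1 := by nlinarith
  set S : Set (E n) := {x | (1 - ‖x‖ ^ 2) / τ ∈ Icc (1 / 4 : ℝ) 2} with hS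
  have hSc : IsClosed S := isClosed_Icc.preimage (by fun_prop)
  have hS1 : ∀ x ∈ S, ‖x‖ ≤ 1 - τ / 8 := by
    intro x hx
    have h1 := hx.1
    rw [le_div_iff₀ hτ] at h1
    by_contra! h
    nlinarith [norm_nonneg x]
  have hz : ∀ x ∉ S, shellField τ x = 0 := fun x hx => shellField_eq_zero hx
  have hDz : ∀ x ∉ S, shellDeriv τ x = 0 := fun x hx => by
    rw [← (hasFDerivAt_shellField τ x).fderiv]
    exact IsTame.fderiv_eq_zero hSc hz hx
  have hDn : ∀ x : E n, ‖shellDeriv τ x‖ ≤ 3 * B / τ := fun x => by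
    by_cases hx : x ∈ S
    · exact norm_shellDeriv_le hτ (by linarith) hB hB1 (by linarith [hS1 x hx])
    · rw [hDz x hx, norm_zero]; positivity
  -- The direct estimate needs both points in the unit ball. Otherwise the shell stays at distance
  -- `τ / 8` from the outer point, so the sup bound `3 * B / τ` serves as a Lipschitz bound; this
  -- produces the constant `24`.
  have hfar : ∀ x y : E n, x ∈ S → ¬ ‖y‖ ≤ 1 →
      ‖shellDeriv τ x - shellDeriv τ y‖ ≤ 24 * B / τ ^ 2 * ‖x - y‖ := by
    intro x y hx hy
    have hyS : y ∉ S := fun h => hy (by linarith [hS1 y h])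
    rw [hDz y hyS, sub_zero]
    have h1 : τ / 8 ≤ ‖x - y‖ := by
      have := norm_sub_norm_le y x
      rw [norm_sub_rev] at this
      linarith [hS1 x hx]
    calc _ ≤ 3 * B / τ := hDn x
      _ = 24 * B / τ ^ 2 * (τ / 8) := by field_simp; norm_num
      _ ≤ _ := by gcongr
  have hDs : ∀ x y : E n, ‖shellDeriv τ x - shellDeriv τ y‖ ≤ 24 * B / τ ^ 2 * ‖x - y‖ := by
    intro x y
    by_cases hx : ‖x‖ ≤ 1
    · by_cases hy : ‖y‖ ≤ 1
      · refine (norm_shellDeriv_sub_le hτ (by linarith) hB hB1 hB2 hB3 hx hy).trans ?_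
        gcongr
        norm_num
      · by_cases hxS : x ∈ S
        · exact hfar x y hxS hy
        · rw [hDz x hxS, hDz y fun h => hy (by linarith [hS1 y h])]
          simp only [sub_zero, norm_zero]; positivity
    · by_cases hyS : y ∈ S
      · rw [norm_sub_rev, norm_sub_rev x]; exact hfar y x hyS hx
      · rw [hDz y hyS, hDz x fun h => hx (by linarith [hS1 x h])]
        simp only [sub_zero, norm_zero]; positivity
  have hD : ∀ x : E n, HasFDerivAt (fun x : E n => (-(c * τ)) • shellField τ x)
      ((-(c * τ)) • shellDeriv τ x) x := fun x => (hasFDerivAt_shellField τ x).fun_const_smul _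
  have hcn : ‖-(c * τ)‖ = c * τ := by rw [norm_neg, Real.norm_of_nonneg (by positivity)]
  have h12 : ∀ x : E n, ‖(-(c * τ)) • shellDeriv τ x‖ ≤ 1 / 2 := fun x => by
    rw [norm_smul, hcn]
    calc _ ≤ c * τ * (3 * B / τ) := by gcongr; exact hDn x
      _ = 3 * (c * B) := by field_simp
      _ = 1 / 2 := by rw [hcB]; norm_num
  have hnv : 0 ≤ 2 * n * v := by positivity
  refine ⟨⟨fun x => ?_, fun x => ?_, fun x y => ?_, fun x => (hD x).differentiableAt, ?_⟩,
    fun x => ?_⟩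
  · rw [norm_smul, hcn]
    have : ‖shellField τ x‖ ≤ 1 := by
      by_cases hx : x ∈ S
      · rw [shellField, norm_smul, Real.norm_of_nonneg (shellBump_nonneg _)]
        exact mul_le_one₀ (shellBump_le_one _) (norm_nonneg _) (by linarith [hS1 x hx])
      · rw [hz x hx, norm_zero]; norm_num
    calc c * τ * ‖shellField τ x‖ ≤ 1 * τ * 1 := by gcongr
      _ ≤ _ := by nlinarith
  · rw [(hD x).fderiv]
    exact (h12 x).trans (by linarith)
  · rw [(hD x).fderiv, (hD y).fderiv]
    have e : (-(c * τ)) • shellDeriv τ x - (-(c * τ)) • shellDeriv τ y =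
      (-(c * τ)) • (shellDeriv τ x - shellDeriv τ y) := (smul_sub _ _ _).symm
    rw [e, norm_smul, hcn]
    calc _ ≤ c * τ * (24 * B / τ ^ 2 * ‖x - y‖) := by gcongr; exact hDs x y
      _ = c * (24 * B / τ * ‖x - y‖) := by field_simp
      _ ≤ 24 * B / τ * ‖x - y‖ := mul_le_of_le_one_left (by positivity) hc1
      _ ≤ _ := by gcongr; linarith
  · refine ⟨S, hSc, (volume_shell_le hn hτ hτ1).trans (ENNReal.ofReal_le_ofReal ?_), fun x hx => ?_⟩
    · gcongr
      linarith
    · rw [hz x hx, smul_zero]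
  · rw [(hD x).fderiv]; exact h12 x

/-- One step raises the lower bound on `1 - ‖x‖ ^ 2` by the factor `1 / (1 - c / 2)`. In the layer
still to be moved the bump is `1` and the norm shrinks by `1 - c * τ`; the first-order gain `c * τ`
exceeds the required `c * τ / 2` by enough to cover the second-order loss when `τ ≤ 1 / 2`. Points
already deep enough only move inward. -/
lemma shell_push {n : ℕ} {c τ : ℝ} (hc : 0 < c) (hc1 : c ≤ 1) (hτ : 0 < τ) (hτ1 : τ ≤ 1 / 2)
    {x : E n} (hx : (1 - c / 2) * τ ≤ 1 - ‖x‖ ^ 2) :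
    τ ≤ 1 - ‖x + (-(c * τ)) • shellField τ x‖ ^ 2 := by
  set z := (1 - ‖x‖ ^ 2) / τ with hz
  have e : x + (-(c * τ)) • shellField τ x = (1 - c * τ * shellBump z) • x := by
    rw [shellField, ← hz]; module
  have hcτ : c * τ ≤ 1 := by nlinarith
  have hcτ0 : 0 < c * τ := by positivity
  have h0 := shellBump_nonneg z
  have h1 := shellBump_le_one z
  have hm0 : 0 ≤ 1 - c * τ * shellBump z := by nlinarith
  have hm1 : 1 - c * τ * shellBump z ≤ 1 := by nlinarith
  rw [e, norm_smul, Real.norm_of_nonneg hm0, mul_pow]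
  by_cases hzz : z ≤ 1
  · have h2 : shellBump z = 1 := by
      refine shellBump_eq_one ?_ hzz
      rw [hz, le_div_iff₀ hτ]
      nlinarith
    rw [h2, mul_one] at hm0 hm1 ⊢
    have h3 : (1 - c * τ) ^ 2 ≤ 1 - c * τ := by nlinarith
    have h4 : (1 - c * τ) ^ 2 * ‖x‖ ^ 2 ≤ (1 - c * τ) * (1 - (1 - c / 2) * τ) :=
      mul_le_mul h3 (by linarith) (by positivity) hm0
    have h5 : 0 ≤ c * τ * (1 - 2 * τ) := by
      apply mul_nonneg hcτ0.le; linarith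
    have h6 : 0 ≤ c * τ * (c * τ) := by positivity
    nlinarith
  · have h2 : τ ≤ 1 - ‖x‖ ^ 2 := by
      rw [not_le, hz, lt_div_iff₀ hτ] at hzz; linarith
    have h3 : (1 - c * τ * shellBump z) ^ 2 ≤ 1 := pow_le_one₀ hm0 hm1
    nlinarith [mul_le_mul_of_nonneg_right h3 (by positivity : 0 ≤ ‖x‖ ^ 2)]

/-- Every compact subset of the unit ball is moved into a fixed smaller ball at bounded cost. -/
theorem exists_reach_push_inside {n : ℕ} (hn : 1 ≤ n) {p s : ℝ} (hp : 1 < p) (hs0 : 0 ≤ s)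
    (hs : s < 1 + 1 / p) :
    ∃ L : ℝ, ∀ K : Set (E n), IsCompact K → K ⊆ Metric.ball 0 1 → ∃ ψ : E n → E n,
      Reach s p (ENNReal.ofReal L) ψ ∧ ∀ x ∈ K, ‖ψ x‖ ^ 2 ≤ 1 / 2 := by
  obtain ⟨M, c, hM, hc, hc1, hT⟩ := shellField_isTame hn
  obtain ⟨C, hC, hR⟩ := exists_reach_displacement (n := n) hn hp hs0 hs (M := M) hM
  have hε : 0 < 1 + 1 / p - s := by linarith
  set ε := 1 + 1 / p - s
  set q := 1 - c / 2 with hq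
  have hq0 : 0 < q := by linarith
  have hq1 : q < 1 := by linarith
  have hr0 : 0 ≤ q ^ ε := by positivity
  have hr1 : q ^ ε < 1 := Real.rpow_lt_one hq0.le hq1 hε
  have h : ∀ J : ℕ, ∃ ψ : E n → E n,
      Reach s p (ENNReal.ofReal (C * ∑ j ∈ Finset.range J, (q ^ ε) ^ j)) ψ ∧
      ∀ x, q ^ J / 2 ≤ 1 - ‖x‖ ^ 2 → ‖ψ x‖ ^ 2 ≤ 1 / 2 := by
    intro J
    induction J with
    | zero => exact ⟨fun x => x, by simpa using reach_id hp, fun x hx => by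
        rw [pow_zero] at hx; linarith⟩
    | succ J ih =>
      obtain ⟨ψ, h1, h2⟩ := ih
      have hqJ : q ^ J ≤ 1 := pow_le_one₀ hq0.le hq1.le
      set τ := q ^ J / 2 with hτd
      have hτ : 0 < τ := by positivity
      have hτ1 : τ ≤ 1 / 2 := by linarith
      obtain ⟨ht, hD⟩ := hT τ hτ hτ1
      have hKb : {x : E n | τ / 4 ≤ 1 - ‖x‖ ^ 2} ⊆ Metric.ball 0 1 := fun x hx => by
        rw [mem_ball_zero_iff]
        have : τ / 4 ≤ 1 - ‖x‖ ^ 2 := hx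
        nlinarith [norm_nonneg x]
      have h3 := hR τ _ hτ (by linarith) ht ((contDiff_shellField τ).const_smul _) hD
        ⟨{x | τ / 4 ≤ 1 - ‖x‖ ^ 2}, Metric.isCompact_of_isClosed_isBounded
          (isClosed_le (by fun_prop) (by fun_prop)) (Metric.isBounded_ball.subset hKb), hKb,
          fun x hx => by
            rw [shellField_eq_zero, smul_zero]
            intro h
            apply hx
            have := h.1
            rw [le_div_iff₀ hτ] at this
            change τ / 4 ≤ 1 - ‖x‖ ^ 2
            linarith⟩
      -- The thinnest, outermost shell acts first: it moves depth `q ^ (J + 1) / 2` to depth `q ^ J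
      -- / 2`, where the inductive map takes over.
      refine ⟨_, (h1.comp h3).mono ?_, fun x hx => ?_⟩
      · rw [← ENNReal.ofReal_add (by positivity) (by positivity), Finset.sum_range_succ, mul_add,
          Real.rpow_pow_comm hq0.le ε J, add_comm]
        apply ENNReal.ofReal_le_ofReal
        gcongr
        linarith
      · refine h2 _ (shell_push hc hc1 hτ hτ1 ?_)
        rw [← hq]
        refine le_trans (le_of_eq ?_) hx
        rw [hτd]; ring
  refine ⟨C * (1 - q ^ ε)⁻¹, fun K hK hKB => ?_⟩
  obtain ⟨r, hr, hKr⟩ := exists_lt_subset_ball hK.isClosed hKB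
  -- The radius `r` may be negative when `K` is empty, hence the `max`.
  have hJ : ∃ J : ℕ, q ^ J < 1 - (max r 0) ^ 2 := by
    refine exists_pow_lt_of_lt_one ?_ hq1
    have h1 : max r 0 < 1 := max_lt hr one_pos
    nlinarith [le_max_right r 0]
  obtain ⟨J, hJ⟩ := hJ
  obtain ⟨ψ, h1, h2⟩ := h J
  refine ⟨ψ, h1.mono (ofReal_mul_geom_sum_le hC hr0 hr1 J), fun x hx => h2 x ?_⟩
  have h3 : ‖x‖ ≤ max r 0 := (mem_ball_zero_iff.1 (hKr hx)).le.trans (le_max_left _ _)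
  have h4 : ‖x‖ ^ 2 ≤ (max r 0) ^ 2 := by gcongr
  have : 0 < q ^ J := by positivity
  linarith

/-! ### Rescaling and conjugating isotopies -/

namespace Isotopy

variable {n : ℕ}

/-- Conjugation of an isotopy by a homothety of ratio `r ≤ 1`. -/
def rescale (I : Isotopy n) {r : ℝ} (hr : 0 < r) (hr1 : r ≤ 1) : Isotopy n where
  f t x := r • I.f t (r⁻¹ • x)
  g t x := r • I.g t (r⁻¹ • x)
  T := I.T
  K := (fun x => r • x) '' I.K
  T_pos := I.T_pos
  smooth_f := (I.smooth_f.comp (contDiff_fst.prodMk (contDiff_snd.const_smul r⁻¹))).const_smul r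
  smooth_g := (I.smooth_g.comp (contDiff_fst.prodMk (contDiff_snd.const_smul r⁻¹))).const_smul r
  left_inv t x := by rw [inv_smul_smul₀ hr.ne', I.left_inv, smul_inv_smul₀ hr.ne']
  right_inv t x := by rw [inv_smul_smul₀ hr.ne', I.right_inv, smul_inv_smul₀ hr.ne']
  isCompact_K := I.isCompact_K.image (by fun_prop)
  K_subset := by
    rintro _ ⟨x, hx, rfl⟩
    have := mem_ball_zero_iff.1 (I.K_subset hx)
    rw [mem_ball_zero_iff, norm_smul, Real.norm_of_nonneg hr.le]
    nlinarith [norm_nonneg x]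
  eq_off t x hx := by
    rw [I.eq_off, smul_inv_smul₀ hr.ne']
    exact fun h => hx ⟨_, h, smul_inv_smul₀ hr.ne' x⟩
  before t ht x := by rw [I.before t ht, smul_inv_smul₀ hr.ne']
  after t ht x := by rw [I.after t ht]

lemma rescale_velocity (I : Isotopy n) {r : ℝ} (hr : 0 < r) (hr1 : r ≤ 1) (t : ℝ) :
    (I.rescale hr hr1).velocity t = fun y => r • I.velocity t (r⁻¹ • y) := by
  funext y
  change deriv (fun τ => r • I.f τ (r⁻¹ • r • I.g t (r⁻¹ • y))) t = _
  rw [inv_smul_smul₀ hr.ne']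
  exact deriv_fun_const_smul r (I.differentiable_f_left _ t)

lemma exists_velocity_bounds (I : Isotopy n) : ∃ M : ℝ, 0 ≤ M ∧ ∀ t, (∀ x, ‖I.velocity t x‖ ≤ M) ∧
    (∀ x, ‖fderiv ℝ (I.velocity t) x‖ ≤ M) ∧
    ∀ x y, ‖fderiv ℝ (I.velocity t) x - fderiv ℝ (I.velocity t) y‖ ≤ M * ‖x - y‖ := by
  have hs := I.contDiff_velocity
  have hc : HasCompactSupport fun q : ℝ × E n => I.velocity q.1 q.2 := by
    refine HasCompactSupport.intro (isCompact_Icc.prod I.isCompact_K : IsCompact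
      (Icc 0 I.T ×ˢ I.K)) ?_
    rintro ⟨t, x⟩ h
    by_cases hx : x ∈ I.K
    · have ht : t ∉ Icc 0 I.T := fun ht => h ⟨ht, hx⟩
      rw [mem_Icc, not_and_or, not_le, not_le] at ht
      rcases ht with ht | ht
      · simp [I.velocity_of_neg ht]
      · simp [I.velocity_of_gt ht]
    · exact I.velocity_eq_zero_of_notMem t hx
  obtain ⟨M, hM, h0, h1, h2⟩ := exists_bounds_of_hasCompactSupport hs hc
  have hD : ∀ t x, fderiv ℝ (I.velocity t) x =
      (fderiv ℝ (fun q : ℝ × E n => I.velocity q.1 q.2) (t, x)).comp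
        (ContinuousLinearMap.inr ℝ ℝ (E n)) := fun t x =>
    (HasFDerivAt.comp (g := fun q : ℝ × E n => I.velocity q.1 q.2) x
      (hs.differentiable (by simp) (t, x)).hasFDerivAt (hasFDerivAt_prodMk_right t x)).fderiv
  have hinr : ∀ A : ℝ × E n →L[ℝ] E n, ‖A.comp (ContinuousLinearMap.inr ℝ ℝ (E n))‖ ≤ ‖A‖ :=
    fun A => (A.opNorm_comp_le _).trans
      (mul_le_of_le_one_right (norm_nonneg _) (ContinuousLinearMap.norm_inr_le_one ℝ ℝ (E n)))
  refine ⟨M, hM, fun t => ⟨fun x => h0 (t, x), fun x => ?_, fun x y => ?_⟩⟩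
  · rw [hD]; exact (hinr _).trans (h1 _)
  · rw [hD, hD, ← ContinuousLinearMap.sub_comp]
    refine (hinr _).trans ((h2 _ _).trans (le_of_eq ?_))
    simp [Prod.norm_def]

/-- Shrinking an isotopy by `q ^ J` makes its velocities tame at scale `q ^ J` with a constant
independent of `J`, while its duration is unchanged; the cost is `O((q ^ J) ^ ε)` with `ε = 1 + 1 /
p - s > 0`. Here `J` depends on the isotopy, which is harmless because compression costs are uniform
in `J`. -/
lemma exists_cost_rescale_le_one (hn : 1 ≤ n) {p s : ℝ} (hp : 1 < p) (hs0 : 0 ≤ s)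
    (hs : s < 1 + 1 / p) (I : Isotopy n) {q : ℝ} (hq0 : 0 < q) (hq1 : q < 1) :
    ∃ J : ℕ, (I.rescale (pow_pos hq0 J) (pow_le_one₀ hq0.le hq1.le)).cost s p ≤ 1 := by
  obtain ⟨M, hM, hb⟩ := I.exists_velocity_bounds
  obtain ⟨C, hC, hCb⟩ := exists_sobolevNorm_le hn hp hs0 hs
    (M := M + volume.real (Metric.ball (0 : E n) 1)) (by positivity)
  have hε : 0 < 1 + 1 / p - s := by linarith
  set ε := 1 + 1 / p - s
  have hr1 : q ^ ε < 1 := Real.rpow_lt_one hq0.le hq1 hε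
  have hT := I.T_pos
  have hpos : 0 < 1 / (C * I.T + 1) := by positivity
  obtain ⟨J, hJ⟩ := exists_pow_lt_of_lt_one hpos hr1
  refine ⟨J, ?_⟩
  refine (Isotopy.cost_le _ hp (c := ENNReal.ofReal (C * (q ^ J) ^ ε)) fun t => ?_).trans ?_
  · rw [rescale_velocity]
    refine hCb _ _ (pow_pos hq0 J) (pow_le_one₀ hq0.le hq1.le) (IsTame.scale hn hM (pow_pos hq0 J)
      (pow_le_one₀ hq0.le hq1.le) ((I.contDiff_velocity_right t).differentiable (by simp))
      (hb t).1 (hb t).2.1 (hb t).2.2 fun x hx => ?_).1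
    exact I.velocity_eq_zero_of_notMem t fun h => hx (Metric.ball_subset_closedBall (I.K_subset h))
  · change ENNReal.ofReal (C * (q ^ J) ^ ε) * ENNReal.ofReal I.T ≤ 1
    rw [← ENNReal.ofReal_mul (by positivity), ENNReal.ofReal_le_one, ← Real.rpow_pow_comm hq0.le]
    rw [lt_div_iff₀ (by positivity)] at hJ
    have : 0 ≤ (q ^ ε) ^ J := by positivity
    nlinarith

/-- Points outside the ball are fixed, so by injectivity no interior point can be sent there. -/
lemma mapsTo_ball (P : Isotopy n) (t : ℝ) {x : E n} (hx : x ∈ Metric.ball 0 1) :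
    P.f t x ∈ Metric.ball 0 1 := by
  by_contra h
  have h1 : P.f t (P.f t x) = P.f t x := P.eq_off t _ fun h' => h (P.K_subset h')
  have h2 : P.f t x = x := by
    have := congrArg (P.g t) h1
    rwa [P.left_inv, P.left_inv] at this
  rw [h2] at h
  exact h hx

/-- Conjugation of an isotopy by the final map of another one. -/
def conj (P I : Isotopy n) : Isotopy n where
  f t x := P.f P.T (I.f t (P.g P.T x))
  g t x := P.f P.T (I.g t (P.g P.T x))
  T := I.T
  K := P.f P.T '' I.K
  T_pos := I.T_pos
  smooth_f := P.smooth_f.comp (contDiff_const.prodMk (I.smooth_f.comp (contDiff_fst.prodMk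
    (P.smooth_g.comp (contDiff_const.prodMk contDiff_snd)))))
  smooth_g := P.smooth_f.comp (contDiff_const.prodMk (I.smooth_g.comp (contDiff_fst.prodMk
    (P.smooth_g.comp (contDiff_const.prodMk contDiff_snd)))))
  left_inv t x := by rw [P.left_inv, I.left_inv, P.right_inv]
  right_inv t x := by rw [P.left_inv, I.right_inv, P.right_inv]
  isCompact_K := I.isCompact_K.image
    (P.smooth_f.continuous.comp (continuous_const.prodMk continuous_id))
  K_subset := by
    rintro _ ⟨x, hx, rfl⟩
    exact P.mapsTo_ball _ (I.K_subset hx)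
  eq_off t x hx := by
    rw [I.eq_off, P.right_inv]
    exact fun h => hx ⟨_, h, P.right_inv _ x⟩
  before t ht x := by rw [I.before t ht, P.right_inv]
  after t ht x := by rw [I.after t ht]

end Isotopy

/-! ### Factoring an arbitrary map into five maps of bounded cost -/

/-- The final map of an isotopy is reached by an isotopy of universally bounded length. -/
theorem exists_reach_bound {n : ℕ} (hn : 1 ≤ n) {p s : ℝ} (hp : 1 < p) (hs0 : 0 ≤ s)
    (hs : s < 1 + 1 / p) : ∃ L : ℝ≥0, ∀ I : Isotopy n, Reach s p L (I.f I.T) := by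
  obtain ⟨L₁, h₁⟩ := exists_reach_push_inside hn hp hs0 hs
  obtain ⟨L₂, q, hq0, hq1, h₂⟩ := exists_reach_linear_compression hn hp hs0 hs
  refine ⟨L₁.toNNReal + L₂.toNNReal + 1 + (L₂.toNNReal + L₁.toNNReal), fun I => ?_⟩
  obtain ⟨_, hψ₁, hK⟩ := h₁ I.K I.isCompact_K I.K_subset
  -- The cost bound is kept in `hψ₁`, while the copy is opened to name an isotopy `P`. Only the maps
  -- of `P` matter for the conjugation, not its length. The same is done for `Q`.
  have hψ₁' := hψ₁
  obtain ⟨P, rfl, -⟩ := hψ₁'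
  set I' := P.conj I with hI'
  have hK' : ∀ x ∈ I'.K, ‖x‖ ^ 2 ≤ 1 / 2 := by
    rintro _ ⟨x, hx, rfl⟩
    exact hK x hx
  obtain ⟨J, hJ⟩ := I'.exists_cost_rescale_le_one hn hp hs0 hs hq0 hq1
  obtain ⟨_, hψ₂, hlin⟩ := h₂ J
  have hψ₂' := hψ₂
  obtain ⟨Q, rfl, -⟩ := hψ₂'
  set r := q ^ J with hr
  have hr0 : 0 < r := pow_pos hq0 J
  -- `Q` intertwines the end of `I'` with its homothetic copy, although it is linear only on the
  -- inner ball. On `I'.K` both the point and its image lie where `Q` is multiplication by `r`. Off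
  -- `I'.K` the end of `I'` is the identity, and injectivity of `Q` shows that `r⁻¹ • Q x` also
  -- avoids `I'.K`.
  have hcomm : ∀ x, Q.f Q.T (I'.f I'.T x) = r • I'.f I'.T (r⁻¹ • Q.f Q.T x) := by
    intro x
    by_cases hx : x ∈ I'.K
    · have hx' : I'.f I'.T x ∈ I'.K := by
        by_contra h
        have h1 := congrArg (I'.g I'.T) (I'.eq_off I'.T _ h)
        rw [I'.left_inv, I'.left_inv] at h1
        rw [h1] at h
        exact h hx
      rw [hlin _ (hK' _ hx'), hlin _ (hK' _ hx), inv_smul_smul₀ hr0.ne']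
    · rw [I'.eq_off _ _ hx, I'.eq_off, smul_inv_smul₀ hr0.ne']
      intro h
      have h1 := hlin _ (hK' _ h)
      rw [smul_inv_smul₀ hr0.ne'] at h1
      have h2 := congrArg (Q.g Q.T) h1
      rw [Q.left_inv, Q.left_inv] at h2
      exact hx (h2 ▸ h)
  have hφ : Reach s p 1 (fun x => r • I'.f I'.T (r⁻¹ • x)) := ⟨_, rfl, hJ⟩
  have hinv₁ := hψ₁.inverse hp (ψ := P.g P.T) fun x => P.right_inv _ x
  have hinv₂ := hψ₂.inverse hp (ψ := Q.g Q.T) fun x => Q.right_inv _ x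
  have h := (hinv₁.comp hinv₂).comp (hφ.comp (hψ₂.comp hψ₁))
  have e : (P.g P.T ∘ Q.g Q.T) ∘ (fun x => r • I'.f I'.T (r⁻¹ • x)) ∘ Q.f Q.T ∘ P.f P.T =
      I.f I.T := by
    funext x
    simp only [Function.comp_apply]
    rw [← hcomm, Q.left_inv]
    change P.g P.T (P.f P.T (I.f I.T (P.g P.T (P.f P.T x)))) = _
    rw [P.left_inv, P.left_inv]
  rw [e] at h
  refine h.mono (le_of_eq ?_)
  push_cast
  rfl

/-! ### Passing between isotopies and paths of diffeomorphisms -/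

/-- A compactly supported diffeomorphism from a pair of inverse smooth maps. -/
def DiffC.ofMaps {n : ℕ} {U : Set (E n)} (f g : E n → E n) (hf : ContDiff ℝ ∞ f)
    (hg : ContDiff ℝ ∞ g) (hl : ∀ x, g (f x) = x) (hr : ∀ x, f (g x) = x) (K : Set (E n))
    (hK : IsCompact K) (hKU : K ⊆ U) (hoff : ∀ x, x ∉ K → f x = x) : DiffC U :=
  ⟨{ toFun := f
     invFun := g
     left_inv := hl
     right_inv := hr
     contMDiff_toFun := hf.contMDiff
     contMDiff_invFun := hg.contMDiff }, by
    have h0 : ∀ x, x ∉ K → f x - x = 0 := fun x hx => by rw [hoff x hx, sub_self]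
    exact ⟨HasCompactSupport.intro hK h0, (closure_minimal (fun x hx => by
      by_contra h
      exact hx (h0 x h)) hK.isClosed).trans hKU⟩⟩

lemma DiffC.exists_support {n : ℕ} {U : Set (E n)} (φ : DiffC U) :
    ∃ K : Set (E n), IsCompact K ∧ K ⊆ U ∧ ∀ x, x ∉ K → φ.1 x = x :=
  ⟨_, φ.2.1, φ.2.2, fun _ hx => sub_eq_zero.1 (image_eq_zero_of_notMem_tsupport (f := fun x => φ.1 x - x) hx)⟩

/-- A path smooth only on `[0, 1]` is reparametrised by the smooth transition, which extends it to
all times, constant outside the interval. Length is irrelevant here: the bound on reachability holds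
for every isotopy. -/
lemma exists_isotopy_of_mem_identityComponent {n : ℕ} {φ : DiffC (Metric.ball (0 : E n) 1)}
    (hφ : φ ∈ identityComponent (Metric.ball (0 : E n) 1)) :
    ∃ I : Isotopy n, ∀ x, I.f I.T x = φ.1 x := by
  obtain ⟨Φ, hΦ, h0, h1⟩ := hφ
  obtain ⟨K, hK, hKB, hoff⟩ := hΦ.support
  set η := Real.smoothTransition with hη
  have hηI : ∀ t, η t ∈ Icc (0 : ℝ) 1 := fun t =>
    ⟨Real.smoothTransition.nonneg t, Real.smoothTransition.le_one t⟩
  have hηs : ContDiff ℝ ∞ η := Real.smoothTransition.contDiff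
  have hf : ContDiff ℝ ∞ fun q : ℝ × E n => (Φ (η q.1)).1 q.2 := by
    rw [← contDiffOn_univ]
    exact hΦ.smooth.comp (((hηs.comp contDiff_fst).prodMk contDiff_snd).contDiffOn (s := univ))
      fun q _ => ⟨hηI q.1, mem_univ _⟩
  have hg : ContDiff ℝ ∞ fun q : ℝ × E n => (Φ (η q.1)).1.symm q.2 := by
    refine contDiff_family_inverse (f := fun t x => (Φ (η t)).1 x)
      (g := fun t x => (Φ (η t)).1.symm x) hf (fun t x => (Φ (η t)).1.symm_apply_apply x)
      (fun t x => (Φ (η t)).1.apply_symm_apply x) fun t x => ?_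
    have d1 : DifferentiableAt ℝ (fun x => (Φ (η t)).1 x) x :=
      (Φ (η t)).1.contMDiff.contDiff.differentiable (by simp) x
    have d2 : DifferentiableAt ℝ (fun x => (Φ (η t)).1.symm x) ((Φ (η t)).1 x) :=
      (Φ (η t)).1.symm.contMDiff.contDiff.differentiable (by simp) _
    have h3 := d2.hasFDerivAt.comp x d1.hasFDerivAt
    have h4 : (fun x => (Φ (η t)).1.symm x) ∘ (fun x => (Φ (η t)).1 x) = id :=
      funext fun x => (Φ (η t)).1.symm_apply_apply x
    rw [h4] at h3
    have h5 := h3.unique (hasFDerivAt_id x)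
    -- The chain rule for the inverse diffeomorphism supplies a left inverse of the spatial
    -- derivative.
    exact Function.LeftInverse.injective fun v => DFunLike.congr_fun h5 v
  refine ⟨⟨fun t x => (Φ (η t)).1 x, fun t x => (Φ (η t)).1.symm x, 1, K, one_pos, hf, hg,
    fun t x => (Φ (η t)).1.symm_apply_apply x, fun t x => (Φ (η t)).1.apply_symm_apply x, hK, hKB,
    fun t x hx => hoff _ (hηI t) x hx, ?_, ?_⟩, ?_⟩
  · intro t ht x
    rw [hη, Real.smoothTransition.zero_of_nonpos ht, h0]
    rfl
  · intro t ht x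
    rw [hη, Real.smoothTransition.one_of_one_le ht, Real.smoothTransition.one_of_one_le le_rfl]
  · intro x
    have h2 : η 1 = 1 := Real.smoothTransition.one_of_one_le le_rfl
    change (Φ (η 1)).1 x = _
    rw [h2, h1]

lemma lintegral_comp_mul_left_eq (S : ℝ → ℝ≥0∞) {a : ℝ} (ha : 0 < a) :
    ENNReal.ofReal a * ∫⁻ t, S (a * t) = ∫⁻ t, S t := by
  conv_rhs => rw [← Real.smul_map_volume_mul_left ha.ne', lintegral_smul_measure]
  rw [(Homeomorph.mulLeft₀ a ha.ne').measurableEmbedding.lintegral_map (fun t => S t) |>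
    fun h => show ∫⁻ t, S t ∂(Measure.map (a * ·) volume) = ∫⁻ t, S (a * t) from h,
    abs_of_pos ha, smul_eq_mul]

/-- Right invariance: precomposing an isotopy with `φ₀` does not change its right-trivialised
velocity. Running it over `[0, 1]` instead of `[0, Q.T]` multiplies the velocity by `Q.T`, which the
change of variables in time cancels. -/
lemma geodesicDist_le_of_reach {n : ℕ} {p s : ℝ} (hp : 1 < p)
    {φ₀ φ₁ : DiffC (Metric.ball (0 : E n) 1)} {L : ℝ≥0∞}
    (h : Reach s p L (fun x => φ₁.1 (φ₀.1.symm x))) : geodesicDist s p φ₀ φ₁ ≤ L := by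
  obtain ⟨Q, hQ, hc⟩ := h
  obtain ⟨K, hK, hKB, hoff⟩ := φ₀.exists_support
  have hφ : ContDiff ℝ ∞ φ₀.1 := φ₀.1.contMDiff.contDiff
  have hφ' : ContDiff ℝ ∞ φ₀.1.symm := φ₀.1.symm.contMDiff.contDiff
  have hfs : ∀ t, ContDiff ℝ ∞ (Q.f t) := fun t =>
    Q.smooth_f.comp (contDiff_const.prodMk contDiff_id)
  have hgs : ∀ t, ContDiff ℝ ∞ (Q.g t) := fun t =>
    Q.smooth_g.comp (contDiff_const.prodMk contDiff_id)
  have hoff' : ∀ t x, x ∉ Q.K ∪ K → Q.f t (φ₀.1 x) = x := fun t x hx => by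
    rw [mem_union, not_or] at hx
    rw [hoff x hx.2, Q.eq_off t x hx.1]
  let Φ : ℝ → DiffC (Metric.ball (0 : E n) 1) := fun t =>
    DiffC.ofMaps (fun x => Q.f (Q.T * t) (φ₀.1 x)) (fun x => φ₀.1.symm (Q.g (Q.T * t) x))
      ((hfs _).comp hφ) (hφ'.comp (hgs _))
      (fun x => by rw [Q.left_inv]; exact φ₀.1.symm_apply_apply x)
      (fun x => by rw [φ₀.1.apply_symm_apply]; exact Q.right_inv _ x)
      (Q.K ∪ K) (Q.isCompact_K.union hK) (union_subset Q.K_subset hKB) (hoff' _)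
  have hΦ : ∀ t x, (Φ t).1 x = Q.f (Q.T * t) (φ₀.1 x) := fun t x => rfl
  have hΦ' : ∀ t x, (Φ t).1.symm x = φ₀.1.symm (Q.g (Q.T * t) x) := fun t x => rfl
  have hpath : IsSmoothPath Φ :=
    ⟨(Q.smooth_f.comp ((contDiff_const.mul contDiff_fst).prodMk (hφ.comp contDiff_snd))).contDiffOn,
      Q.K ∪ K, Q.isCompact_K.union hK, union_subset Q.K_subset hKB, fun t _ x hx => hoff' _ x hx⟩
  have hstart : Φ 0 = φ₀ := by
    refine Subtype.ext (Diffeomorph.ext fun x => ?_)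
    rw [hΦ, mul_zero, Q.before 0 le_rfl]
  have hend : Φ 1 = φ₁ := by
    refine Subtype.ext (Diffeomorph.ext fun x => ?_)
    rw [hΦ, mul_one, hQ]
    simp only [Diffeomorph.symm_apply_apply]
  have hvel : ∀ t ∈ Icc (0 : ℝ) 1, velocity Φ t = fun y => Q.T • Q.velocity (Q.T * t) y := by
    intro t ht
    funext y
    unfold velocity
    simp only [hΦ, hΦ', Diffeomorph.apply_symm_apply]
    have h1 : HasDerivAt (fun τ => Q.f τ (Q.g (Q.T * t) y)) (Q.velocity (Q.T * t) y) (Q.T * t) :=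
      (Q.differentiable_f_left _ _).hasDerivAt
    have h2 : HasDerivAt (fun τ : ℝ => Q.T * τ) Q.T t := by
      simpa using (hasDerivAt_id t).const_mul Q.T
    exact (HasDerivAt.scomp t h1 h2).hasDerivWithinAt.derivWithin
      (uniqueDiffOn_Icc one_pos t ht)
  refine (iInf₂_le Φ ⟨hpath, hstart, hend⟩).trans (le_trans ?_ hc)
  unfold length
  rw [setLIntegral_congr_fun (g := fun t => ENNReal.ofReal Q.T *
    sobolevNorm s p (Q.velocity (Q.T * t))) measurableSet_Icc (fun t ht => by
      rw [hvel t ht, sobolevNorm_const_smul hp _ (Q.contDiff_velocity_right _), ← ofReal_norm,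
        Real.norm_of_nonneg Q.T_pos.le]),
    lintegral_const_mul' _ _ ENNReal.ofReal_ne_top]
  refine le_trans ?_ (lintegral_comp_mul_left_eq
    (fun t => sobolevNorm s p (Q.velocity t)) Q.T_pos).le
  gcongr
  exact Measure.restrict_le_self

theorem exists_diameter_le {n : ℕ} (hn : 1 ≤ n) {p s : ℝ} (hp : 1 < p) (hs0 : 0 ≤ s)
    (hs : s < 1 + 1 / p) : ∃ L : ℝ≥0, diameter s p (Metric.ball (0 : E n) 1) ≤ L := by
  obtain ⟨L, hL⟩ := exists_reach_bound hn hp hs0 hs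
  refine ⟨L, iSup₂_le fun φ₀ h₀ => iSup₂_le fun φ₁ h₁ => geodesicDist_le_of_reach hp ?_⟩
  obtain ⟨I₀, hI₀⟩ := exists_isotopy_of_mem_identityComponent h₀
  obtain ⟨I₁, hI₁⟩ := exists_isotopy_of_mem_identityComponent h₁
  -- Undoing `φ₀` and then doing `φ₁` is an isotopy ending at `φ₁ ∘ φ₀⁻¹`, so the uniform bound
  -- applies to the quotient directly.
  have h := hL (I₀.symm.trans I₁)
  have e : (I₀.symm.trans I₁).f (I₀.symm.trans I₁).T = fun x => φ₁.1 (φ₀.1.symm x) := by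
    funext x
    change I₁.f (I₀.T + I₁.T - I₀.T) (I₀.symm.f (I₀.T + I₁.T) x) = _
    rw [add_sub_cancel_left, hI₁,
      I₀.symm.after (I₀.T + I₁.T) (le_add_of_nonneg_right I₁.T_pos.le)]
    change φ₁.1 (I₀.f (I₀.T - I₀.T) (I₀.g I₀.T x)) = _
    rw [sub_self, I₀.before 0 le_rfl]
    congr 1
    rw [← φ₀.1.symm_apply_apply (I₀.g I₀.T x), ← hI₀, I₀.right_inv]
  rwa [e] at h

end SobolevDiff

end


theorem mainTheorem5 (n : ℕ) (hn : 1 ≤ n) (p : ℝ) (hp : 1 < p) (s : ℝ) (hs0 : 0 ≤ s)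
    (hs : s < 1 + 1 / p) :
    ∃ C : ℝ≥0, SobolevDiff.diameter s p (Metric.ball (0 : SobolevDiff.E n) 1) < (C : ℝ≥0∞) := by
  obtain ⟨L, hL⟩ := SobolevDiff.exists_diameter_le hn hp hs0 hs
  exact ⟨L + 1, hL.trans_lt (by exact_mod_cast lt_add_one L)⟩
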